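/- Let $\mathsf X,\mathsf Z$ be measurable spaces, the $\sigma$-algebra of $\mathsf Z$ being countably generated (e.g. $\mathsf Z$ finite or standard Borel). Let $Q_{\mathsf X}$ be a probability measure on $\mathsf X$, $P_{\mathsf Z|\mathsf X}$ a Markov kernel from $\mathsf X$ to $\mathsf Z$ (the channel to the eavesdropper), and $\pi_{\mathsf Z}$ a probability measure on $\mathsf Z$ (the law of each symbol observed by the eavesdropper when no message is sent). Let $Q_{\mathsf Z}$ be the output law of $P_{\mathsf Z|\mathsf X}$ under input $Q_{\mathsf X}$, let $D(\cdot\|\cdot)\in[0,\infty]$ denote relative entropy (natural logarithm), $I(Q_{\mathsf X},P_{\mathsf Z|\mathsf X})=D(Q_{\mathsf X}P_{\mathsf Z|\mathsf X}\,\|\,Q_{\mathsf X}\otimes Q_{\mathsf Z})\in[0,\infty]$ mutual information, and $[x]^+=\max\{x,0\}$. Let $R,R_{\mathsf L}\ge 0$ and $0<\bar\epsilon<1$. For $n\ge1$ let $M_n=\lceil e^{nR}\rceil$ and $L_n=\lceil e^{nR_{\mathsf L}}\rceil$. A codebook is an array $c=(c_{wl})$, $1\le w\le M_n$, $1\le l\le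 L_n$, of words in $\mathsf X^n$; to send message $w$, the word $c_{wl}$ with $l$ equiprobable on $\{1,\dots,L_n\}$ is put into the memoryless channel, so that the eavesdropper observes $z\in\mathsf Z^n$ with law $\frac1{L_n}\sum_{l} P^{\otimes n}_{\mathsf Z|\mathsf X}(\cdot\,|\,c_{wl})$; when no message is sent, $z$ has law $\pi_{\mathsf Z}^{\otimes n}$. For real $A>0$ and an integer $T\ge1$, the eavesdropper can perform $(A,T,\bar\epsilon)$-decoding for $c$ if there is a (measurable) decoder that maps each $z\in\mathsf Z^n$ either to the declaration "no message" or to a list of at most $T$ messages, such that, when no message is sent, it declares "no message" with probability at least $1-A^{-1}$, and, when message $m$ is sent, it outputs a list containing $m$ with probability at least $\epsilon_m$, for some numbers $\epsilon_m$ with $\frac1{M_n}\sum_{m=1}^{M_n}\epsilon_m=\bar\epsilon$. A pair $(\alpha,\tau)\in\mathbb R^2$ is $\bar\epsilon$-achievable by the eavesdropper if there are reals $A_n>0$ and integers $T_n\ge 1$ with $\frac1n\log A_n\to\alpha$ and $\frac1n\log T_n\to\tau$ such that, when all codewords are drawn i.i.d. from $Q_{\mathsf X}^{\otimes n}$, with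 probability tending to $1$ as $n\to\infty$ the eavesdropper can perform $(A_n,T_n,\bar\epsilon)$-decoding for the random codebook. Then $(\alpha,\tau)$ is $\bar\epsilon$-achievable by the eavesdropper if and only if $$\alpha\le D(Q_{\mathsf Z}\|\pi_{\mathsf Z})+[I(Q_{\mathsf X},P_{\mathsf Z|\mathsf X})-R-R_{\mathsf L}]^+,\qquad \tau\ge R-[I(Q_{\mathsf X},P_{\mathsf Z|\mathsf X})-R_{\mathsf L}]^+\quad\text{and}\quad \tau\ge0 .$$ -/

import Mathlib

open MeasureTheory ProbabilityTheory InformationTheory Filter Topology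
open scoped ENNReal

namespace Wiretap

noncomputable section

/-- Output law of the stationary memoryless channel `P_{Z|X}^{⊗n}` for the input word `x`. -/
def memorylessChannel {X Z : Type*} [MeasurableSpace X] [MeasurableSpace Z]
    (P : Kernel X Z) (n : ℕ) (x : Fin n → X) : Measure (Fin n → Z) :=
  Measure.pi fun i => P (x i)

/-- Law of the observation when message `m` is sent with codebook `c`: the index `l` of the
codeword `c m l` is equiprobable on the `L` possible values. -/
def messageLaw {X Z : Type*} [MeasurableSpace Z] (W : X → Measure Z) {M L : ℕ}
    (c : Fin M → Fin L → X) (m : Fin M) : Measure Z :=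
  (L : ℝ≥0∞)⁻¹ • ∑ l, W (c m l)

/-- An eavesdropper's decoder: from the observation it either declares that no message was sent
(`none`) or outputs a list of messages (`some s`). -/
structure ListDecoder (Z : Type*) [MeasurableSpace Z] (M : ℕ) where
  decode : Z → Option (Finset (Fin M))
  measurableSet_fiber : ∀ o, MeasurableSet (decode ⁻¹' {o})

/-- `(A, T, ε)`-decoding for a fixed codebook `c`, channel `W` and non-message law `π`. -/
def CanDecode {X Z : Type*} [MeasurableSpace Z] (W : X → Measure Z) (π : Measure Z) {M L : ℕ}
    (c : Fin M → Fin L → X) (A : ℝ) (T : ℕ) (ε : ℝ) : Prop :=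
  ∃ d : ListDecoder Z M,
    (∀ z s, d.decode z = some s → s.card ≤ T) ∧
    1 - A⁻¹ ≤ π.real {z | d.decode z = none} ∧
    ∃ e : Fin M → ℝ,
      (∀ m, e m ≤ (messageLaw W c m).real {z | ∃ s, d.decode z = some s ∧ m ∈ s}) ∧
      ε = (∑ m, e m) / M

/-- Law of the `(M, L, Q^{⊗n})`-random code: all codewords are i.i.d. according to `Q^{⊗n}`. -/
def randomCode {X : Type*} [MeasurableSpace X] (Q : Measure X) (n M L : ℕ) :
    Measure (Fin M → Fin L → Fin n → X) :=
  Measure.pi fun _ => Measure.pi fun _ => Measure.pi fun _ => Q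

/-- The integer number of indices at rate `r` and blocklength `n`. -/
def codeSize (r : ℝ) (n : ℕ) : ℕ := ⌈Real.exp (n * r)⌉₊

/-- The pair `(α, τ)` is `ε`-achievable by the eavesdropper at rates `(R, RL)`. The sets `S n` are
(measurable) sets of codebooks for which decoding succeeds, of probability tending to one. -/
def Achievable {X Z : Type*} [MeasurableSpace X] [MeasurableSpace Z]
    (Q : Measure X) (P : Kernel X Z) (π : Measure Z) (R RL ε α τ : ℝ) : Prop :=
  ∃ (A : ℕ → ℝ) (T : ℕ → ℕ),
    (∀ n, 0 < A n) ∧ (∀ n, 0 < T n) ∧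
    Tendsto (fun n : ℕ => Real.log (T n) / n) atTop (𝓝 τ) ∧
    Tendsto (fun n : ℕ => Real.log (A n) / n) atTop (𝓝 α) ∧
    ∃ S : ∀ n, Set (Fin (codeSize R n) → Fin (codeSize RL n) → Fin n → X),
      (∀ n, MeasurableSet (S n)) ∧
      (∀ n, ∀ c ∈ S n, CanDecode (memorylessChannel P n) (Measure.pi fun _ : Fin n => π) c
        (A n) (T n) ε) ∧
      Tendsto (fun n => randomCode Q n (codeSize R n) (codeSize RL n) (S n)) atTop (𝓝 1)

/-- Mutual information `I(Q, P)` of the input law `Q` and the channel `P`: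
the relative entropy of the joint law with respect to the product of its marginals. -/
def mutualInfo {X Z : Type*} [MeasurableSpace X] [MeasurableSpace Z]
    (Q : Measure X) (P : Kernel X Z) : ℝ≥0∞ :=
  klDiv (Q ⊗ₘ P) (Q.prod (P ∘ₘ Q))

end

end Wiretap

/-! Write `D` for the divergence of `P ∘ₘ Q` from `π`, `I` for the mutual information, `u` for the
density of `Q ⊗ₘ P` with respect to `Q.prod (P ∘ₘ Q)` and `v` for that of `P ∘ₘ Q` with respect to
`π`. By the law of large numbers, the product of the `u`'s along a transmitted word and its output
is about `exp (n I)`, and the product of the `v`'s along the output is about `exp (n D)`. Everything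
else is Markov's inequality applied to these products over a random codebook.

Direct part (`one_shot_direct`, `exists_codebooks_of_lt`). For `a < D` and `b < I`, the decoder
tests whether the `v`-product reaches `exp (n a)` and lists the messages having a codeword whose
`u`-product reaches `exp (n b)`. Without a message, the first test passes with probability at most
`exp (-n a)`, and for a fixed observation some codeword passes the second with probability at most
`min 1 (M L exp (-n b))`; this gives the exponent `a + [b - R - RL]⁺`. With a message, a wrong
message is listed with probability at most `min 1 (L exp (-n b))`, so the expected number of wrong
ones has exponent `R - [b - RL]⁺`. A diagonal choice of `a` and `b` reaches the boundary
(`achievable_of_le`).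

Converse. By soft covering (`soft_covering`), the output law of an equiprobable choice among `exp (n
r)` random codewords has, outside an event of vanishing probability, a density of at most about `exp
(n [I - r]⁺)` with respect to the i.i.d. law of `P ∘ₘ Q`. With `r = RL` and the fact that the
decoding events of all messages have total mass at most `T` under any law, the success probability
is at most about `exp (n [I - RL]⁺) T / M` (`one_shot_list_converse`). With `r = R + RL` and a
further change of measure to `π`, it is at most about `exp (n ([I - R - RL]⁺ + D)) / A`
(`one_shot_detection_converse`). Beyond the claimed region these bounds vanish, so no positive
average success probability survives. -/

namespace Wiretap

/-! ### Integrals and densities on finite products. -/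

section Product

theorem lintegral_pi_prod {ι : Type*} [Fintype ι] {Y : ι → Type*} [∀ i, MeasurableSpace (Y i)]
    (μ : ∀ i, Measure (Y i)) [∀ i, IsProbabilityMeasure (μ i)] {f : ∀ i, Y i → ℝ≥0∞}
    (hf : ∀ i, Measurable (f i)) :
    ∫⁻ x, ∏ i, f i (x i) ∂Measure.pi μ = ∏ i, ∫⁻ y, f i y ∂μ i := by
  refine (lintegral_prod_eq_prod_lintegral_of_indepFun Finset.univ
    (fun i (x : ∀ i, Y i) => f i (x i)) (iIndepFun_pi fun i => (hf i).aemeasurable)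
    (fun i => (hf i).comp (measurable_pi_apply i))).trans ?_
  refine Finset.prod_congr rfl fun i _ => ?_
  exact (measurePreserving_eval μ i).lintegral_comp (hf i)

theorem pi_withDensity {ι : Type*} [Fintype ι] {Y : ι → Type*} [∀ i, MeasurableSpace (Y i)]
    (μ ν : ∀ i, Measure (Y i)) [∀ i, IsProbabilityMeasure (μ i)] [∀ i, IsProbabilityMeasure (ν i)]
    {f : ∀ i, Y i → ℝ≥0∞} (hf : ∀ i, Measurable (f i)) (h : ∀ i, ν i = (μ i).withDensity (f i)) :
    Measure.pi ν = (Measure.pi μ).withDensity fun x => ∏ i, f i (x i) := by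
  refine Measure.pi_eq fun s hs => ?_
  rw [withDensity_apply _ (MeasurableSet.univ_pi hs), ← lintegral_indicator (MeasurableSet.univ_pi hs)]
  have : ∀ x : ∀ i, Y i, (Set.univ.pi s).indicator (fun x => ∏ i, f i (x i)) x
      = ∏ i, (s i).indicator (f i) (x i) := by
    intro x
    by_cases hx : x ∈ Set.univ.pi s
    · rw [Set.indicator_of_mem hx]
      exact Finset.prod_congr rfl fun i _ => (Set.indicator_of_mem (hx i trivial) _).symm
    · rw [Set.indicator_of_notMem hx]
      simp only [Set.mem_pi, Set.mem_univ, true_implies, not_forall] at hx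
      obtain ⟨i, hi⟩ := hx
      exact (Finset.prod_eq_zero (Finset.mem_univ i) (Set.indicator_of_notMem hi _)).symm
  simp_rw [this]
  rw [lintegral_pi_prod μ fun i => (hf i).indicator (hs i)]
  refine Finset.prod_congr rfl fun i _ => ?_
  rw [h i, withDensity_apply _ (hs i), lintegral_indicator (hs i)]

end Product

/-! ### The memoryless extension of a channel. -/

section Memoryless

variable {X Z : Type*} [MeasurableSpace X] [MeasurableSpace Z]

instance (P : Kernel X Z) [IsMarkovKernel P] (n : ℕ) (x : Fin n → X) :
    IsProbabilityMeasure (memorylessChannel P n x) := by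
  unfold memorylessChannel; infer_instance

theorem measurable_memorylessChannel (P : Kernel X Z) [IsMarkovKernel P] (n : ℕ) :
    Measurable (memorylessChannel P n) := by
  refine Measurable.measure_of_isPiSystem_of_isProbabilityMeasure generateFrom_pi.symm
    isPiSystem_pi ?_
  rintro _ ⟨s, hs, rfl⟩
  have hs : ∀ i, MeasurableSet (s i) := fun i => hs i trivial
  simp only [memorylessChannel, Measure.pi_pi]
  exact Finset.measurable_prod _ fun i _ =>
    (Kernel.measurable_coe P (hs i)).comp (measurable_pi_apply i)

/-- The memoryless channel as a Markov kernel. -/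
noncomputable def memorylessKernel (P : Kernel X Z) [IsMarkovKernel P] (n : ℕ) :
    Kernel (Fin n → X) (Fin n → Z) :=
  ⟨memorylessChannel P n, measurable_memorylessChannel P n⟩

theorem memorylessKernel_apply (P : Kernel X Z) [IsMarkovKernel P] (n : ℕ) (x : Fin n → X) :
    memorylessKernel P n x = memorylessChannel P n x := rfl

instance (P : Kernel X Z) [IsMarkovKernel P] (n : ℕ) : IsMarkovKernel (memorylessKernel P n) :=
  ⟨fun x => by rw [memorylessKernel_apply]; infer_instance⟩

/-- Pairing of an input word with an output word, letter by letter. -/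
def zipWord (n : ℕ) (p : (Fin n → X) × (Fin n → Z)) : Fin n → X × Z := fun i => (p.1 i, p.2 i)

theorem measurable_zipWord (n : ℕ) : Measurable (zipWord (X := X) (Z := Z) n) := by
  unfold zipWord; fun_prop

/-- Regrouped letter by letter, a random word and its output form an i.i.d. sequence, which is what
lets the law of large numbers act on product densities. -/
theorem map_zipWord_compProd (Q : Measure X) [IsProbabilityMeasure Q] (P : Kernel X Z)
    [IsMarkovKernel P] (n : ℕ) :
    ((Measure.pi fun _ : Fin n => Q) ⊗ₘ memorylessKernel P n).map (zipWord n)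
      = Measure.pi fun _ : Fin n => Q ⊗ₘ P := by
  refine (Measure.pi_eq fun s hs => ?_).symm
  rw [Measure.map_apply (measurable_zipWord n) (MeasurableSet.univ_pi hs),
    Measure.compProd_apply (measurable_zipWord n (MeasurableSet.univ_pi hs))]
  have : ∀ x : Fin n → X, memorylessKernel P n x
      (Prod.mk x ⁻¹' (zipWord n ⁻¹' (Set.univ.pi s))) = ∏ i, P (x i) (Prod.mk (x i) ⁻¹' s i) := by
    intro x
    rw [memorylessKernel_apply, memorylessChannel, ← Measure.pi_pi]
    refine congrArg _ ?_
    ext z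
    simp [zipWord]
  simp_rw [this]
  rw [lintegral_pi_prod (fun _ : Fin n => Q)
    (f := fun i x => P x (Prod.mk x ⁻¹' s i)) fun i => Kernel.measurable_kernel_prodMk_left (hs i)]
  exact Finset.prod_congr rfl fun i _ => (Measure.compProd_apply (hs i)).symm

theorem memorylessKernel_comp (Q : Measure X) [IsProbabilityMeasure Q] (P : Kernel X Z)
    [IsMarkovKernel P] (n : ℕ) :
    memorylessKernel P n ∘ₘ (Measure.pi fun _ : Fin n => Q) = Measure.pi fun _ : Fin n => P ∘ₘ Q := by
  have h := congrArg (Measure.map fun (y : Fin n → X × Z) i => (y i).2) (map_zipWord_compProd Q P n)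
  rw [Measure.map_map (by fun_prop) (measurable_zipWord n),
    Measure.pi_map_pi (fun _ => measurable_snd.aemeasurable)] at h
  rw [show (Q ⊗ₘ P).map (fun y => y.2) = P ∘ₘ Q from Measure.snd_compProd Q P] at h
  rw [← h, ← Measure.snd_compProd]
  rfl

end Memoryless

/-! ### Laws of large numbers for products of densities. -/

section LawOfLargeNumbers

variable {Y : Type*} [MeasurableSpace Y]

/-- Embeds all blocklengths in one infinite sequence, where the strong law applies. -/
theorem map_infinitePi_fin (μ : Measure Y) [IsProbabilityMeasure μ] (n : ℕ) :
    (Measure.infinitePi fun _ : ℕ => μ).map (fun ω (i : Fin n) => ω i) =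
      Measure.pi fun _ : Fin n => μ := by
  have h : iIndepFun (fun (i : ℕ) (ω : ℕ → Y) => ω i) (Measure.infinitePi fun _ : ℕ => μ) :=
    iIndepFun_infinitePi (X := fun _ y => y) fun _ => measurable_id
  have h2 := h.precomp (g := fun i : Fin n => (i : ℕ)) Fin.val_injective
  rw [iIndepFun_iff_map_fun_eq_pi_map (fun i => (measurable_pi_apply _).aemeasurable)] at h2
  rw [h2]
  congr 1
  ext1 i
  exact Measure.infinitePi_map_eval (fun _ : ℕ => μ) i

theorem weak_law (μ : Measure Y) [IsProbabilityMeasure μ] {g : Y → ℝ} (hg : Measurable g)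
    (hgi : Integrable g μ) {δ : ℝ} (hδ : 0 < δ) :
    Tendsto (fun n : ℕ => (Measure.pi fun _ : Fin n => μ)
      {y | δ ≤ |(∑ i, g (y i)) / n - ∫ x, g x ∂μ|}) atTop (𝓝 0) := by
  set Pinf := Measure.infinitePi fun _ : ℕ => μ
  have hind : iIndepFun (fun (i : ℕ) (ω : ℕ → Y) => g (ω i)) Pinf :=
    iIndepFun_infinitePi (X := fun _ y => g y) fun _ => hg
  have hmp : ∀ i, MeasurePreserving (fun ω : ℕ → Y => ω i) Pinf μ := fun i =>
    ⟨measurable_pi_apply i, Measure.infinitePi_map_eval (fun _ : ℕ => μ) i⟩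
  have hmean : ∀ i, ∫ ω, g (ω i) ∂Pinf = ∫ x, g x ∂μ := fun i => by
    rw [← (hmp i).map_eq, integral_map (hmp i).measurable.aemeasurable hg.aestronglyMeasurable]
  have hsl := strong_law_ae_real (μ := Pinf) (fun i ω => g (ω i))
    ((hmp 0).integrable_comp_of_integrable hgi)
    (fun i j hij => hind.indepFun hij)
    (fun i => ⟨(hg.comp (hmp i).measurable).aemeasurable, (hg.comp (hmp 0).measurable).aemeasurable, by
      change Measure.map (g ∘ fun ω : ℕ → Y => ω i) Pinf = Measure.map (g ∘ fun ω : ℕ → Y => ω 0) Pinf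
      rw [← Measure.map_map hg (hmp i).measurable, ← Measure.map_map hg (hmp 0).measurable,
        (hmp i).map_eq, (hmp 0).map_eq]⟩)
  rw [hmean 0] at hsl
  have hmeas : ∀ n : ℕ, Measurable fun ω : ℕ → Y => (∑ i ∈ Finset.range n, g (ω i)) / n := by
    intro n; fun_prop
  have htm := tendstoInMeasure_of_tendsto_ae (fun n => (hmeas n).aestronglyMeasurable) hsl
  rw [tendstoInMeasure_iff_dist] at htm
  refine (htm δ hδ).congr fun n => ?_
  rw [← map_infinitePi_fin μ n, Measure.map_apply (by fun_prop)
    (measurableSet_le measurable_const (by fun_prop))]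
  congr 1
  ext ω
  simp only [Set.mem_ofPred_eq, Set.mem_preimage, Real.dist_eq]
  rw [Fin.sum_univ_eq_sum_range (fun i => g (ω i)) n]

theorem ae_pi_of_ae {n : ℕ} (μ : Measure Y) [IsProbabilityMeasure μ] {p : Y → Prop}
    (h : ∀ᵐ y ∂μ, p y) : ∀ᵐ y ∂(Measure.pi fun _ : Fin n => μ), ∀ i, p (y i) :=
  ae_all_iff.2 fun i => (measurePreserving_eval (fun _ : Fin n => μ) i).quasiMeasurePreserving.ae h

theorem prod_eq_ofReal_exp_sum {n : ℕ} {a : Fin n → ℝ≥0∞} (h0 : ∀ i, a i ≠ 0) (ht : ∀ i, a i ≠ ∞) :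
    ∏ i, a i = ENNReal.ofReal (Real.exp (∑ i, Real.log (a i).toReal)) := by
  rw [Real.exp_sum, ENNReal.ofReal_prod_of_nonneg fun _ _ => (Real.exp_pos _).le]
  refine Finset.prod_congr rfl fun i _ => ?_
  rw [Real.exp_log (ENNReal.toReal_pos (h0 i) (ht i)), ENNReal.ofReal_toReal (ht i)]

/-- The logarithm of the product is a sum of i.i.d. integrable terms. This upper tail serves the
converse; the lower tail `tendsto_pi_prod_lt` serves the direct part. -/
theorem tendsto_pi_prod_gt (μ : Measure Y) [IsProbabilityMeasure μ] {h : Y → ℝ≥0∞}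
    (hm : Measurable h) (h0 : ∀ᵐ y ∂μ, h y ≠ 0) (ht : ∀ᵐ y ∂μ, h y ≠ ∞)
    (hi : Integrable (fun y => Real.log (h y).toReal) μ) {t : ℝ}
    (hlt : ∫ y, Real.log (h y).toReal ∂μ < t) :
    Tendsto (fun n : ℕ => (Measure.pi fun _ : Fin n => μ)
      {y | ENNReal.ofReal (Real.exp (n * t)) < ∏ i, h (y i)}) atTop (𝓝 0) := by
  refine tendsto_of_tendsto_of_tendsto_of_le_of_le tendsto_const_nhds
    (weak_law μ (g := fun y => Real.log (h y).toReal) (by fun_prop) hi (sub_pos.2 hlt))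
    (fun _ => zero_le) fun n => ?_
  refine measure_mono_ae ?_
  filter_upwards [ae_pi_of_ae (n := n) μ h0, ae_pi_of_ae (n := n) μ ht] with y hy0 hyt hy
  change ENNReal.ofReal _ < _ at hy
  rw [prod_eq_ofReal_exp_sum hy0 hyt, ENNReal.ofReal_lt_ofReal_iff (Real.exp_pos _), Real.exp_lt_exp]
    at hy
  change _ ≤ |_|
  -- For `n = 0` both sides of `hy` are zero, so the strict inequality is impossible.
  rcases Nat.eq_zero_or_pos n with rfl | hn
  · simp at hy
  have hn' : (0 : ℝ) < n := by exact_mod_cast hn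
  refine le_trans ?_ (le_abs_self _)
  have : t ≤ (∑ i, Real.log (h (y i)).toReal) / n := by
    rw [le_div_iff₀ hn']; linarith
  linarith

theorem tendsto_pi_prod_lt (μ : Measure Y) [IsProbabilityMeasure μ] {h : Y → ℝ≥0∞}
    (hm : Measurable h) (h0 : ∀ᵐ y ∂μ, h y ≠ 0) (ht : ∀ᵐ y ∂μ, h y ≠ ∞)
    (hi : Integrable (fun y => Real.log (h y).toReal) μ) {t : ℝ}
    (hlt : t < ∫ y, Real.log (h y).toReal ∂μ) :
    Tendsto (fun n : ℕ => (Measure.pi fun _ : Fin n => μ)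
      {y | ∏ i, h (y i) < ENNReal.ofReal (Real.exp (n * t))}) atTop (𝓝 0) := by
  refine tendsto_of_tendsto_of_tendsto_of_le_of_le tendsto_const_nhds
    (weak_law μ (g := fun y => Real.log (h y).toReal) (by fun_prop) hi (sub_pos.2 hlt))
    (fun _ => zero_le) fun n => ?_
  refine measure_mono_ae ?_
  filter_upwards [ae_pi_of_ae (n := n) μ h0, ae_pi_of_ae (n := n) μ ht] with y hy0 hyt hy
  change _ < ENNReal.ofReal _ at hy
  rw [prod_eq_ofReal_exp_sum hy0 hyt, ENNReal.ofReal_lt_ofReal_iff (Real.exp_pos _), Real.exp_lt_exp]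
    at hy
  change _ ≤ |_|
  rcases Nat.eq_zero_or_pos n with rfl | hn
  · simp at hy
  have hn' : (0 : ℝ) < n := by exact_mod_cast hn
  refine le_trans ?_ (neg_le_abs _)
  have : (∑ i, Real.log (h (y i)).toReal) / n ≤ t := by
    rw [div_le_iff₀ hn']; linarith
  linarith

end LawOfLargeNumbers

/-! ### Densities with prescribed mean logarithm, for finite or infinite divergence. -/

section Divergence

variable {Ω : Type*} [MeasurableSpace Ω]

theorem log_density_of_klDiv_ne_top (μ ν : Measure Ω) [IsProbabilityMeasure μ]
    [IsProbabilityMeasure ν] (h : klDiv μ ν ≠ ∞) :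
    ν.withDensity (μ.rnDeriv ν) = μ ∧ (∀ᵐ ω ∂μ, μ.rnDeriv ν ω ≠ 0) ∧
      (∀ᵐ ω ∂μ, μ.rnDeriv ν ω ≠ ∞) ∧
      Integrable (fun ω => Real.log (μ.rnDeriv ν ω).toReal) μ ∧
      ∫ ω, Real.log (μ.rnDeriv ν ω).toReal ∂μ = (klDiv μ ν).toReal := by
  obtain ⟨hac, hint⟩ := klDiv_ne_top_iff.1 h
  refine ⟨Measure.withDensity_rnDeriv_eq μ ν hac, ?_, ?_, hint, ?_⟩
  · filter_upwards [Measure.rnDeriv_pos hac] with ω hω using hω.ne'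
  · exact hac.ae_le ((Measure.rnDeriv_lt_top μ ν).mono fun _ h => h.ne)
  · rw [toReal_klDiv_of_measure_eq hac (by simp)]
    rfl

/-- From `log x ≥ 1 - 1 / x`. It makes the negative part of a log-density integrable at no cost, so
only the positive part can make a divergence infinite. -/
theorem mul_ofReal_neg_log_le_one (x : ℝ≥0∞) : x * ENNReal.ofReal (-Real.log x.toReal) ≤ 1 := by
  rcases eq_or_ne x ∞ with rfl | hx
  · simp
  rcases eq_or_ne x 0 with rfl | h0
  · simp
  have hpos := ENNReal.toReal_pos h0 hx
  nth_rw 1 [← ENNReal.ofReal_toReal hx]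
  rw [← ENNReal.ofReal_mul hpos.le, ← ENNReal.ofReal_one]
  refine ENNReal.ofReal_le_ofReal ?_
  have h1 := Real.one_sub_inv_le_log_of_pos hpos
  have h2 : x.toReal * (1 - x.toReal⁻¹) ≤ x.toReal * Real.log x.toReal :=
    mul_le_mul_of_nonneg_left h1 hpos.le
  rw [mul_sub, mul_inv_cancel₀ hpos.ne'] at h2
  linarith

theorem integrable_of_lintegral_ofReal {μ : Measure Ω} {g : Ω → ℝ} (hg : Measurable g)
    (h1 : ∫⁻ ω, ENNReal.ofReal (g ω) ∂μ ≠ ∞) (h2 : ∫⁻ ω, ENNReal.ofReal (-g ω) ∂μ ≠ ∞) :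
    Integrable g μ := by
  refine ⟨hg.aestronglyMeasurable, ?_⟩
  rw [hasFiniteIntegral_iff_norm]
  refine lt_of_le_of_lt (lintegral_mono fun ω => ?_)
    (lt_of_le_of_lt (lintegral_add_left (hg.ennreal_ofReal) _).le
      (ENNReal.add_lt_top.2 ⟨h1.lt_top, h2.lt_top⟩))
  rw [Real.norm_eq_abs]
  rcases le_total 0 (g ω) with h | h
  · rw [abs_of_nonneg h]; exact le_self_add
  · rw [abs_of_nonpos h]; exact le_add_self

/-- Truncate the density at height `K + 1`. The negative parts of the logarithms have integral at
most `1` uniformly in `K`; if the mean logarithms stayed below `a`, monotone convergence would bound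
the integral of the untruncated positive part. That would force `μ ≪ ν` with integrable
log-likelihood ratio, hence finite divergence. -/
theorem exists_truncated_density_of_klDiv_eq_top (μ ν : Measure Ω) [IsProbabilityMeasure μ]
    [IsProbabilityMeasure ν] (htop : klDiv μ ν = ∞) (a : ℝ) :
    ∃ h : Ω → ℝ≥0∞, Measurable h ∧ ν.withDensity h ≤ μ ∧ (∀ᵐ ω ∂μ, h ω ≠ 0) ∧
      (∀ᵐ ω ∂μ, h ω ≠ ∞) ∧ Integrable (fun ω => Real.log (h ω).toReal) μ ∧
      a < ∫ ω, Real.log (h ω).toReal ∂μ := by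
  classical
  obtain ⟨s, hs, hs0, hsν⟩ := Measure.mutuallySingular_singularPart μ ν
  set f := μ.rnDeriv ν
  have hf : Measurable f := Measure.measurable_rnDeriv μ ν
  -- The complement of `s` is `ν`-null and carries the singular part of `μ`; the value `∞` there
  -- makes the truncations grow without bound on it.
  set F : Ω → ℝ≥0∞ := s.piecewise f fun _ => ∞
  have hF : Measurable F := hf.piecewise hs measurable_const
  set h : ℕ → Ω → ℝ≥0∞ := fun K ω => min (F ω) (K + 1)
  have hh : ∀ K, Measurable (h K) := fun K => hF.min measurable_const
  have hdec : μ.restrict s = (ν.withDensity f).restrict s := by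
    conv_lhs => rw [Measure.haveLebesgueDecomposition_add μ ν]
    rw [Measure.restrict_add, Measure.restrict_eq_zero.2 hs0, zero_add]
  have hFs : ∀ ω ∈ s, F ω = f ω := fun ω hω => Set.piecewise_eq_of_mem _ _ _ hω
  have hFsc : ∀ ω ∉ s, F ω = ∞ := fun ω hω => Set.piecewise_eq_of_notMem _ _ _ hω
  have hle : ∀ K, ν.withDensity (h K) ≤ μ := fun K => by
    refine le_trans (withDensity_mono ?_) (Measure.withDensity_rnDeriv_le μ ν)
    have : ∀ᵐ ω ∂ν, ω ∈ s := hsν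
    filter_upwards [this] with ω hω
    exact (min_le_left _ _).trans (hFs ω hω).le
  have hF0 : ∀ᵐ ω ∂μ, F ω ≠ 0 := by
    have h1 : ∀ᵐ ω ∂μ.restrict s, f ω ≠ 0 := by
      rw [hdec]
      refine ae_restrict_of_ae ?_
      rw [ae_withDensity_iff hf]
      exact ae_of_all _ fun _ h => h
    rw [ae_restrict_iff' hs] at h1
    filter_upwards [h1] with ω hω
    by_cases hm : ω ∈ s
    · rw [hFs ω hm]; exact hω hm
    · rw [hFsc ω hm]; simp
  have hK1 : ∀ K : ℕ, (1 : ℝ≥0∞) ≤ K + 1 := fun K => le_add_self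
  have hKt : ∀ K : ℕ, (K + 1 : ℝ≥0∞) ≠ ∞ := fun K => by finiteness
  have hh0 : ∀ K, ∀ᵐ ω ∂μ, h K ω ≠ 0 := fun K => by
    filter_upwards [hF0] with ω hω
    exact (lt_min (pos_iff_ne_zero.2 hω) (lt_of_lt_of_le one_pos (hK1 K))).ne'
  have hht : ∀ K ω, h K ω ≠ ∞ := fun K ω => ne_top_of_le_ne_top (hKt K) (min_le_right _ _)
  set G : Ω → ℝ≥0∞ := s.indicator fun ω => ENNReal.ofReal (-Real.log (f ω).toReal)
  have hG : ∫⁻ ω, G ω ∂μ ≤ 1 := by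
    rw [lintegral_indicator hs, hdec, restrict_withDensity hs,
      lintegral_withDensity_eq_lintegral_mul _ hf (by fun_prop)]
    calc _ ≤ ∫⁻ _, 1 ∂(ν.restrict s) := lintegral_mono fun ω => mul_ofReal_neg_log_le_one (f ω)
      _ = ν s := by simp
      _ ≤ 1 := prob_le_one
  have hneg : ∀ K ω, ENNReal.ofReal (-Real.log (h K ω).toReal) ≤ G ω := by
    intro K ω
    rcases le_total 1 (F ω) with h1 | h1
    · have : 1 ≤ (h K ω).toReal := by
        rw [← ENNReal.toReal_one]
        exact ENNReal.toReal_mono (hht K ω) (le_min h1 (hK1 K))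
      rw [ENNReal.ofReal_of_nonpos (by linarith [Real.log_nonneg this])]
      exact zero_le
    · have hm : ω ∈ s := by
        by_contra hm
        rw [hFsc ω hm] at h1
        simp at h1
      have : h K ω = f ω := by
        rw [← hFs ω hm]; exact min_eq_left (h1.trans (hK1 K))
      rw [this]
      exact (Set.indicator_of_mem hm (fun ω => ENNReal.ofReal (-Real.log (f ω).toReal))).ge
  have hnegint : ∀ K, ∫⁻ ω, ENNReal.ofReal (-Real.log (h K ω).toReal) ∂μ ≤ 1 := fun K =>
    (lintegral_mono (hneg K)).trans hG
  have hint : ∀ K, Integrable (fun ω => Real.log (h K ω).toReal) μ := fun K => by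
    refine integrable_of_lintegral_ofReal (by have := hh K; fun_prop) ?_
      (ne_top_of_le_ne_top ENNReal.one_ne_top (hnegint K))
    refine ne_top_of_le_ne_top (b := ENNReal.ofReal (Real.log (K + 1))) ENNReal.ofReal_ne_top ?_
    calc _ ≤ ∫⁻ _, ENNReal.ofReal (Real.log (K + 1)) ∂μ := lintegral_mono_ae ?_
      _ = _ := by simp
    filter_upwards [hh0 K] with ω hω
    refine ENNReal.ofReal_le_ofReal (Real.log_le_log (ENNReal.toReal_pos hω (hht K ω)) ?_)
    refine (ENNReal.toReal_mono (hKt K) (min_le_right (F ω) _)).trans (le_of_eq ?_)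
    rw [ENNReal.toReal_add (by simp) (by simp)]; simp
  by_contra hcon
  have hle_a : ∀ K, ∫ ω, Real.log (h K ω).toReal ∂μ ≤ a := fun K => by
    by_contra hlt
    exact hcon ⟨h K, hh K, hle K, hh0 K, ae_of_all _ (hht K), hint K, not_le.1 hlt⟩
  have hpos : ∀ K, ∫⁻ ω, ENNReal.ofReal (Real.log (h K ω).toReal) ∂μ ≤ ENNReal.ofReal (a + 1) := by
    intro K
    have e := integral_eq_lintegral_pos_part_sub_lintegral_neg_part (hint K)
    have e2 : (∫⁻ ω, ENNReal.ofReal (-Real.log (h K ω).toReal) ∂μ).toReal ≤ 1 :=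
      ENNReal.toReal_le_of_le_ofReal zero_le_one (by simpa using hnegint K)
    have hfin : ∫⁻ ω, ENNReal.ofReal (Real.log (h K ω).toReal) ∂μ ≠ ∞ := (hint K).lintegral_lt_top.ne
    rw [← ENNReal.ofReal_toReal hfin]
    exact ENNReal.ofReal_le_ofReal (by linarith [hle_a K])
  have hmono : ∀ᵐ ω ∂μ, Monotone fun K => ENNReal.ofReal (Real.log (h K ω).toReal) := by
    filter_upwards [hF0] with ω hω K K' hKK
    refine ENNReal.ofReal_le_ofReal (Real.log_le_log (ENNReal.toReal_pos ?_ (hht K ω))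
      (ENNReal.toReal_mono (hht K' ω) (min_le_min_left _ ?_)))
    · exact (lt_min (pos_iff_ne_zero.2 hω) (lt_of_lt_of_le one_pos (hK1 K))).ne'
    · gcongr
  have hsup : ∫⁻ ω, ⨆ K, ENNReal.ofReal (Real.log (h K ω).toReal) ∂μ ≤ ENNReal.ofReal (a + 1) := by
    rw [lintegral_iSup' (fun K => by have := hh K; fun_prop) hmono]
    exact iSup_le hpos
  have hsupm : Measurable fun ω => ⨆ K, ENNReal.ofReal (Real.log (h K ω).toReal) :=
    Measurable.iSup fun K => by have := hh K; fun_prop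
  have hae := ae_lt_top hsupm (ne_top_of_le_ne_top ENNReal.ofReal_ne_top hsup)
  have hμs : ∀ᵐ ω ∂μ, ω ∈ s := by
    filter_upwards [hae] with ω hω
    by_contra hm
    refine hω.ne (ENNReal.eq_top_of_forall_nnreal_le fun r => ?_)
    obtain ⟨K, hK⟩ := exists_nat_ge (Real.exp r)
    refine le_trans ?_ (le_iSup _ K)
    have : h K ω = K + 1 := by simp [h, hFsc ω hm]
    rw [this, ← ENNReal.ofReal_coe_nnreal]
    refine ENNReal.ofReal_le_ofReal ?_
    have hK' : ((K : ℝ≥0∞) + 1).toReal = K + 1 := by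
      rw [ENNReal.toReal_add (by simp) (by simp)]; simp
    rw [hK', Real.le_log_iff_exp_le (by positivity)]
    linarith
  have hac : μ ≪ ν := by
    refine (Measure.singularPart_eq_zero μ ν).1 ?_
    refine Measure.measure_univ_eq_zero.1 (le_antisymm ?_ zero_le)
    rw [← Set.union_compl_self s]
    refine (measure_union_le _ _).trans ?_
    rw [hs0, zero_add]
    exact (Measure.singularPart_le μ ν _).trans (le_of_eq hμs)
  refine klDiv_ne_top hac (integrable_of_lintegral_ofReal (measurable_llr μ ν) ?_ ?_) htop
  · refine ne_top_of_le_ne_top ENNReal.ofReal_ne_top (le_trans (lintegral_mono_ae ?_) hsup)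
    filter_upwards [hμs, hac.ae_le (Measure.rnDeriv_lt_top μ ν)] with ω hm hft
    obtain ⟨K, hK⟩ := exists_nat_ge (f ω).toReal
    refine le_trans (le_of_eq ?_) (le_iSup _ K)
    have : h K ω = f ω := by
      rw [← hFs ω hm]
      refine min_eq_left ?_
      change f ω < ∞ at hft
      rw [hFs ω hm, ← ENNReal.ofReal_toReal hft.ne]
      refine (ENNReal.ofReal_le_ofReal hK).trans ?_
      simp
    rw [this]; rfl
  · refine ne_top_of_le_ne_top ENNReal.one_ne_top (le_trans (lintegral_mono_ae ?_) hG)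
    filter_upwards [hμs] with ω hm
    exact (Set.indicator_of_mem hm (fun ω => ENNReal.ofReal (-Real.log (f ω).toReal))).ge

/-- The direct part only needs a sub-density whose mean logarithm exceeds `a`; this form treats
finite and infinite divergence alike. -/
theorem exists_density_of_lt_klDiv (μ ν : Measure Ω) [IsProbabilityMeasure μ]
    [IsProbabilityMeasure ν] {a : ℝ} (ha : (a : EReal) < (klDiv μ ν : EReal)) :
    ∃ h : Ω → ℝ≥0∞, Measurable h ∧ ν.withDensity h ≤ μ ∧ (∀ᵐ ω ∂μ, h ω ≠ 0) ∧
      (∀ᵐ ω ∂μ, h ω ≠ ∞) ∧ Integrable (fun ω => Real.log (h ω).toReal) μ ∧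
      a < ∫ ω, Real.log (h ω).toReal ∂μ := by
  by_cases htop : klDiv μ ν = ∞
  · exact exists_truncated_density_of_klDiv_eq_top μ ν htop a
  · obtain ⟨h1, h2, h3, h4, h5⟩ := log_density_of_klDiv_ne_top μ ν htop
    refine ⟨_, Measure.measurable_rnDeriv μ ν, h1.le, h2, h3, h4, ?_⟩
    rw [h5]
    rw [← ENNReal.ofReal_toReal htop, EReal.coe_ennreal_ofReal, max_eq_left ENNReal.toReal_nonneg] at ha
    exact_mod_cast ha

end Divergence

/-! ### Information densities normalised at every output. -/

section MutualInformation

variable {X Z : Type*} [MeasurableSpace X] [MeasurableSpace Z]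

/-- The second marginal of `Q ⊗ₘ P` is `P ∘ₘ Q`, so the bound holds outside a `P ∘ₘ Q`-null set `E`,
and erasing `h` over `E` makes it hold for every `z`. Almost every `z` would not do: the false-alarm
bound takes `z` from `π`, which may charge `E`. -/
theorem exists_normalized_density (Q : Measure X) [IsProbabilityMeasure Q] (P : Kernel X Z)
    [IsMarkovKernel P] {h : X × Z → ℝ≥0∞} (hm : Measurable h)
    (hle : (Q.prod (P ∘ₘ Q)).withDensity h ≤ Q ⊗ₘ P) :
    ∃ E : Set Z, MeasurableSet E ∧ (P ∘ₘ Q) E = 0 ∧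
      ∀ z, ∫⁻ x, (Prod.snd ⁻¹' Eᶜ).indicator h (x, z) ∂Q ≤ 1 := by
  have hgm : Measurable fun z => ∫⁻ x, h (x, z) ∂Q := hm.lintegral_prod_left'
  have hae : (fun z => ∫⁻ x, h (x, z) ∂Q) ≤ᵐ[P ∘ₘ Q] fun _ => 1 := by
    refine ae_le_of_forall_setLIntegral_le_of_sigmaFinite hgm fun B hB _ => ?_
    have h1 : ∫⁻ z in B, ∫⁻ x, h (x, z) ∂Q ∂(P ∘ₘ Q)
        = ((Q.prod (P ∘ₘ Q)).withDensity h) (Set.univ ×ˢ B) := by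
      rw [withDensity_apply _ (MeasurableSet.univ.prod hB), ← Measure.prod_restrict,
        lintegral_prod_symm' _ hm, Measure.restrict_univ]
    rw [h1]
    refine (hle _).trans (le_of_eq ?_)
    rw [setLIntegral_one, ← Measure.snd_compProd, Measure.snd_apply hB, Set.univ_prod]
  refine ⟨{z | 1 < ∫⁻ x, h (x, z) ∂Q}, measurableSet_lt measurable_const hgm, ?_, fun z => ?_⟩
  · rw [Filter.EventuallyLE, ae_iff] at hae
    simpa using hae
  · by_cases hz : 1 < ∫⁻ x, h (x, z) ∂Q
    · rw [lintegral_eq_zero_of_ae_eq_zero]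
      · exact zero_le
      · refine ae_of_all _ fun x => ?_
        refine Set.indicator_of_notMem ?_ _
        simpa using hz
    · refine le_trans (lintegral_mono fun x => Set.indicator_le_self _ _ _) (not_lt.1 hz)

theorem ae_indicator_snd_eq (Q : Measure X) [IsProbabilityMeasure Q] (P : Kernel X Z)
    [IsMarkovKernel P] {E : Set Z} (hE : MeasurableSet E) (h0 : (P ∘ₘ Q) E = 0)
    (h : X × Z → ℝ≥0∞) : ∀ᵐ p ∂(Q ⊗ₘ P), (Prod.snd ⁻¹' Eᶜ).indicator h p = h p := by
  have : ∀ᵐ p ∂(Q ⊗ₘ P), p.2 ∉ E := by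
    rw [← Measure.snd_compProd, Measure.snd_apply hE] at h0
    rw [ae_iff]
    simp only [not_not]
    exact h0
  filter_upwards [this] with p hp
  exact Set.indicator_of_mem (by simpa using hp) _

theorem exists_density_of_lt_mutualInfo (Q : Measure X) [IsProbabilityMeasure Q] (P : Kernel X Z)
    [IsMarkovKernel P] {b : ℝ} (hb : (b : EReal) < (mutualInfo Q P : EReal)) :
    ∃ h : X × Z → ℝ≥0∞, Measurable h ∧ (∀ z, ∫⁻ x, h (x, z) ∂Q ≤ 1) ∧
      (∀ᵐ p ∂(Q ⊗ₘ P), h p ≠ 0) ∧ (∀ᵐ p ∂(Q ⊗ₘ P), h p ≠ ∞) ∧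
      Integrable (fun p => Real.log (h p).toReal) (Q ⊗ₘ P) ∧
      b < ∫ p, Real.log (h p).toReal ∂(Q ⊗ₘ P) := by
  obtain ⟨h, hm, hle, h0, ht, hi, hlt⟩ := exists_density_of_lt_klDiv _ _ hb
  obtain ⟨E, hE, hE0, hE1⟩ := exists_normalized_density Q P hm hle
  have hae := ae_indicator_snd_eq Q P hE hE0 h
  refine ⟨(Prod.snd ⁻¹' Eᶜ).indicator h, hm.indicator (measurable_snd hE.compl), hE1, ?_, ?_, ?_, ?_⟩
  · filter_upwards [hae, h0] with p hp hp0; rwa [hp]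
  · filter_upwards [hae, ht] with p hp hp0; rwa [hp]
  · refine hi.congr ?_
    filter_upwards [hae] with p hp; rw [hp]
  · refine hlt.trans_eq (integral_congr_ae ?_)
    filter_upwards [hae] with p hp; rw [hp]

/-- The last clause disintegrates the joint density: the kernel Radon–Nikodym derivative of `P`
against the constant kernel, available because `Z` is countably generated, agrees with `h'` by
uniqueness of densities. The converse needs it to give each codeword's output law a density. -/
theorem exists_density_of_mutualInfo_ne_top [MeasurableSpace.CountablyGenerated Z]
    (Q : Measure X) [IsProbabilityMeasure Q] (P : Kernel X Z)
    [IsMarkovKernel P] (htop : mutualInfo Q P ≠ ∞) :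
    ∃ h : X × Z → ℝ≥0∞, Measurable h ∧ (∀ z, ∫⁻ x, h (x, z) ∂Q ≤ 1) ∧
      (∀ᵐ p ∂(Q ⊗ₘ P), h p ≠ 0) ∧ (∀ᵐ p ∂(Q ⊗ₘ P), h p ≠ ∞) ∧
      Integrable (fun p => Real.log (h p).toReal) (Q ⊗ₘ P) ∧
      ∫ p, Real.log (h p).toReal ∂(Q ⊗ₘ P) = (mutualInfo Q P).toReal ∧
      ∀ᵐ x ∂Q, P x = (P ∘ₘ Q).withDensity fun z => h (x, z) := by
  obtain ⟨heq, h0, ht, hi, hint⟩ := log_density_of_klDiv_ne_top (Q ⊗ₘ P) (Q.prod (P ∘ₘ Q)) htop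
  set h := (Q ⊗ₘ P).rnDeriv (Q.prod (P ∘ₘ Q))
  have hm : Measurable h := Measure.measurable_rnDeriv _ _
  obtain ⟨E, hE, hE0, hE1⟩ := exists_normalized_density Q P hm heq.le
  have hae := ae_indicator_snd_eq Q P hE hE0 h
  set h' := (Prod.snd ⁻¹' Eᶜ).indicator h
  have hm' : Measurable h' := hm.indicator (measurable_snd hE.compl)
  refine ⟨h', hm', hE1, ?_, ?_, ?_, ?_, ?_⟩
  · filter_upwards [hae, h0] with p hp hp0; rwa [hp]
  · filter_upwards [hae, ht] with p hp hp0; rwa [hp]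
  · refine hi.congr ?_
    filter_upwards [hae] with p hp; rw [hp]
  · refine Eq.trans (integral_congr_ae ?_) hint
    filter_upwards [hae] with p hp; rw [hp]
  · have heq' : (Q.prod (P ∘ₘ Q)).withDensity h' = Q ⊗ₘ P := by
      rw [← heq]
      refine withDensity_congr_ae ?_
      have : ∀ᵐ p ∂(Q.prod (P ∘ₘ Q)), p.2 ∉ E := by
        rw [ae_iff]
        have : {p : X × Z | ¬ p.2 ∉ E} = Set.univ ×ˢ E := by ext; simp
        rw [this, Measure.prod_prod, hE0, mul_zero]
      filter_upwards [this] with p hp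
      exact Set.indicator_of_mem (by simpa using hp) _
    set η : Kernel X Z := Kernel.const X (P ∘ₘ Q)
    have hac : ∀ᵐ x ∂Q, P x ≪ η x := by
      have : Q ⊗ₘ P ≪ Q ⊗ₘ η → _ := fun h => (Measure.absolutelyContinuous_compProd_iff'.1 h).2
      refine this ?_
      rw [Measure.compProd_const]
      exact (klDiv_ne_top_iff.1 htop).1
    have hrd : ∀ᵐ x ∂Q, η.withDensity (P.rnDeriv η) x = P x := by
      filter_upwards [hac] with x hx using Kernel.withDensity_rnDeriv_eq hx
    have hrdm : Measurable fun p : X × Z => P.rnDeriv η p.1 p.2 := Kernel.measurable_rnDeriv P η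
    have hcp : (Q.prod (P ∘ₘ Q)).withDensity (fun p => P.rnDeriv η p.1 p.2) = Q ⊗ₘ P := by
      rw [← Measure.compProd_congr hrd, Measure.compProd_withDensity hrdm, Measure.compProd_const]
    have hae2 : ∀ᵐ p ∂(Q.prod (P ∘ₘ Q)), P.rnDeriv η p.1 p.2 = h' p := by
      refine (withDensity_eq_iff hrdm.aemeasurable hm'.aemeasurable ?_).1 (hcp.trans heq'.symm)
      rw [← setLIntegral_univ, ← withDensity_apply _ MeasurableSet.univ, hcp]
      exact measure_ne_top _ _
    filter_upwards [hrd, Measure.ae_ae_of_ae_prod hae2] with x hx1 hx2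
    rw [← hx1, Kernel.withDensity_apply _ hrdm]
    exact withDensity_congr_ae hx2

end MutualInformation

/-! ### Pairwise independence of the codewords. -/

section RandomCode

variable {X : Type*} [MeasurableSpace X]

/-- Uncurrying the codebook reduces the claim to independence of two coordinates of one product
measure. No more than pairwise independence is used for first moments. -/
theorem map_pair_pi_pi (q : Measure X) [IsProbabilityMeasure q] {M L : ℕ}
    {k k' : Fin M × Fin L} (hk : k ≠ k') :
    (Measure.pi fun _ : Fin M => Measure.pi fun _ : Fin L => q).map
      (fun c => (c k.1 k.2, c k'.1 k'.2)) = q.prod q := by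
  have h1 : (Measure.pi fun _ : Fin M => Measure.pi fun _ : Fin L => q)
      = (Measure.infinitePi fun _ : Fin M × Fin L => q).map (MeasurableEquiv.curry _ _ X) := by
    rw [Measure.infinitePi_map_curry (fun _ _ => q)]
    simp_rw [Measure.infinitePi_eq_pi]
  have hind : iIndepFun (fun (i : Fin M × Fin L) (f : Fin M × Fin L → X) => f i)
      (Measure.infinitePi fun _ : Fin M × Fin L => q) :=
    iIndepFun_infinitePi (X := fun _ x => x) fun _ => measurable_id
  have h2 := (indepFun_iff_map_prod_eq_prod_map_map (measurable_pi_apply k).aemeasurable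
    (measurable_pi_apply k').aemeasurable).1 (hind.indepFun hk)
  rw [Measure.infinitePi_map_eval (fun _ : Fin M × Fin L => q),
    Measure.infinitePi_map_eval (fun _ : Fin M × Fin L => q)] at h2
  rw [h1, Measure.map_map (by fun_prop) (MeasurableEquiv.measurable _), ← h2]
  rfl

theorem map_eval_pi_pi (q : Measure X) [IsProbabilityMeasure q] {M L : ℕ} (m : Fin M) (l : Fin L) :
    (Measure.pi fun _ : Fin M => Measure.pi fun _ : Fin L => q).map (fun c => c m l) = q := by
  have h1 := (measurePreserving_eval (fun _ : Fin L => q) l).comp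
    (measurePreserving_eval (fun _ : Fin M => Measure.pi fun _ : Fin L => q) m)
  exact h1.map_eq

end RandomCode

/-! ### Random codebook together with a channel output; soft covering. -/

section Joint

variable {Ω X Z : Type*} [MeasurableSpace Ω] [MeasurableSpace X] [MeasurableSpace Z]

theorem map_compProd_comap (μ : Measure Ω) [IsProbabilityMeasure μ] (W : Kernel X Z)
    [IsMarkovKernel W] {f : Ω → X} (hf : Measurable f) :
    (μ ⊗ₘ W.comap f hf).map (fun p => (f p.1, p.2)) = (μ.map f) ⊗ₘ W := by
  have := Measure.isProbabilityMeasure_map (μ := μ) hf.aemeasurable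
  ext G hG
  have hm : Measurable fun p : Ω × Z => (f p.1, p.2) := by fun_prop
  rw [Measure.map_apply hm hG, Measure.compProd_apply (hm hG), Measure.compProd_apply hG,
    lintegral_map (Kernel.measurable_kernel_prodMk_left hG) hf]
  rfl

/-- The output comes from the codeword `f`, so an independent codeword `g` is independent of the
output as well. -/
theorem map_compProd_comap_of_indep (μ : Measure Ω) [IsProbabilityMeasure μ] (W : Kernel X Z)
    [IsMarkovKernel W] {f g : Ω → X} (hf : Measurable f) (hg : Measurable g) {q : Measure X}
    [IsProbabilityMeasure q] (h : μ.map (fun ω => (f ω, g ω)) = q.prod q) :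
    (μ ⊗ₘ W.comap f hf).map (fun p => (g p.1, p.2)) = q.prod (W ∘ₘ q) := by
  ext G hG
  have hm : Measurable fun p : Ω × Z => (g p.1, p.2) := by fun_prop
  rw [Measure.map_apply hm hG, Measure.compProd_apply (hm hG), Measure.prod_apply hG]
  have hmeas : Measurable fun p : X × X => W p.1 (Prod.mk p.2 ⁻¹' G) := by
    have := Kernel.measurable_kernel_prodMk_left (κ := W.comap (Prod.fst : X × X → X) measurable_fst)
      (t := {y : (X × X) × Z | (y.1.2, y.2) ∈ G}) ((by fun_prop : Measurable
        fun y : (X × X) × Z => (y.1.2, y.2)) hG)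
    exact this
  have h1 : ∫⁻ ω, W.comap f hf ω (Prod.mk ω ⁻¹' ((fun p : Ω × Z => (g p.1, p.2)) ⁻¹' G)) ∂μ
      = ∫⁻ p, W p.1 (Prod.mk p.2 ⁻¹' G) ∂(μ.map fun ω => (f ω, g ω)) := by
    rw [lintegral_map hmeas (by fun_prop)]
    rfl
  rw [h1, h, lintegral_prod_symm' _ hmeas]
  refine lintegral_congr fun x => ?_
  rw [Measure.bind_apply (measurable_prodMk_left hG) W.aemeasurable]

theorem lintegral_kernel_comap (μ : Measure Ω) [IsProbabilityMeasure μ] (W : Kernel X Z)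
    [IsMarkovKernel W] {f : Ω → X} (hf : Measurable f) {G : Set (Ω × Z)} (hG : MeasurableSet G) :
    ∫⁻ ω, W (f ω) (Prod.mk ω ⁻¹' G) ∂μ = (μ ⊗ₘ W.comap f hf) G :=
  (Measure.compProd_apply (κ := W.comap f hf) hG).symm

theorem measurable_kernel_comap (W : Kernel X Z)
    [IsMarkovKernel W] {f : Ω → X} (hf : Measurable f) {G : Set (Ω × Z)} (hG : MeasurableSet G) :
    Measurable fun ω => W (f ω) (Prod.mk ω ⁻¹' G) :=
  Kernel.measurable_kernel_prodMk_left (κ := W.comap f hf) hG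

theorem lintegral_other_codeword_le (μ : Measure Ω) [IsProbabilityMeasure μ] (W : Kernel X Z)
    [IsMarkovKernel W] {f g : Ω → X} (hf : Measurable f) (hg : Measurable g) {q : Measure X}
    [IsProbabilityMeasure q] (h : μ.map (fun ω => (f ω, g ω)) = q.prod q)
    {U : X × Z → ℝ≥0∞} (hU : Measurable U) (hU1 : ∀ z, ∫⁻ x, U (x, z) ∂q ≤ 1) :
    ∫⁻ p, U (g p.1, p.2) ∂(μ ⊗ₘ W.comap f hf) ≤ 1 := by
  rw [← lintegral_map (g := fun p : Ω × Z => (g p.1, p.2)) hU (by fun_prop),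
    map_compProd_comap_of_indep μ W hf hg h, lintegral_prod_symm' _ hU]
  calc _ ≤ ∫⁻ _, 1 ∂(W ∘ₘ q) := lintegral_mono hU1
    _ = 1 := by simp

/-- One-shot soft covering: with respect to the law of a transmitted codeword and the output, the
average density of the codebook is unlikely to exceed `γ`. -/
theorem soft_covering {K : Type*} [Fintype K] [Nonempty K] (μ : Measure Ω) [IsProbabilityMeasure μ]
    (W : Kernel X Z) [IsMarkovKernel W] {C : K → Ω → X} (hC : ∀ k, Measurable (C k))
    {q : Measure X} [IsProbabilityMeasure q] (hev : ∀ k, μ.map (C k) = q)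
    (hpair : ∀ k k', k ≠ k' → μ.map (fun ω => (C k ω, C k' ω)) = q.prod q)
    {U : X × Z → ℝ≥0∞} (hU : Measurable U) (hU1 : ∀ z, ∫⁻ x, U (x, z) ∂q ≤ 1)
    {t γ : ℝ≥0∞} (hγ0 : γ ≠ 0) (hγ : γ ≠ ∞) (ht : 2 * t ≤ γ * Fintype.card K) (k : K) :
    (μ ⊗ₘ W.comap (C k) (hC k)) {p | γ * Fintype.card K < ∑ j, U (C j p.1, p.2)}
      ≤ (q ⊗ₘ W) {p | t < U p} + 2 / γ := by
  classical
  set J := μ ⊗ₘ W.comap (C k) (hC k)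
  have hN0 : (Fintype.card K : ℝ≥0∞) ≠ 0 := by simp
  have hNt : (Fintype.card K : ℝ≥0∞) ≠ ∞ := by simp
  have hUC : ∀ j, Measurable fun p : Ω × Z => U (C j p.1, p.2) := fun j => by
    have := hC j; fun_prop
  -- The threshold is halved. The sent codeword contributes at most `t`, hence at most one half,
  -- unless its own density is atypically large. The other codewords contribute at most `1` each on
  -- average, and Markov's inequality yields `2 / γ`.
  have hsub : {p : Ω × Z | γ * Fintype.card K < ∑ j, U (C j p.1, p.2)}
      ⊆ {p | t < U (C k p.1, p.2)} ∪
        {p | γ * Fintype.card K / 2 ≤ ∑ j ∈ Finset.univ.erase k, U (C j p.1, p.2)} := by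
    intro p hp
    by_contra hcon
    simp only [Set.mem_union, Set.mem_ofPred_eq, not_or, not_lt, not_le] at hcon hp
    rw [← Finset.add_sum_erase _ _ (Finset.mem_univ k)] at hp
    refine absurd hp (not_lt.2 ?_)
    rw [← ENNReal.add_halves (γ * Fintype.card K)]
    refine add_le_add (hcon.1.trans ?_) hcon.2.le
    rw [ENNReal.le_div_iff_mul_le (by simp) (by simp), mul_comm]
    exact ht
  refine (measure_mono hsub).trans ((measure_union_le _ _).trans (add_le_add ?_ ?_))
  · rw [← hev k, ← map_compProd_comap μ W (hC k), Measure.map_apply (by have := hC k; fun_prop)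
      (measurableSet_lt measurable_const hU)]
    exact le_rfl
  · have hd0 : γ * Fintype.card K / 2 ≠ 0 := by
      simp [ENNReal.div_eq_zero_iff, hγ0]
    have hdt : γ * Fintype.card K / 2 ≠ ∞ := by
      finiteness
    refine (meas_ge_le_lintegral_div (by fun_prop) hd0 hdt).trans ?_
    rw [lintegral_finsetSum _ fun j _ => hUC j]
    have hs : ∑ j ∈ Finset.univ.erase k, ∫⁻ p, U (C j p.1, p.2) ∂J ≤ Fintype.card K := by
      calc _ ≤ ∑ j ∈ Finset.univ.erase k, (1 : ℝ≥0∞) := Finset.sum_le_sum fun j hj =>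
            lintegral_other_codeword_le μ W (hC k) (hC j)
              (hpair k j (Finset.ne_of_mem_erase hj).symm) hU hU1
        _ ≤ ∑ j : K, (1 : ℝ≥0∞) := Finset.sum_le_sum_of_subset (Finset.erase_subset _ _)
        _ = _ := by simp
    refine (ENNReal.div_le_div_right hs _).trans (le_of_eq ?_)
    rw [ENNReal.div_eq_div_iff hγ0 hγ hd0 hdt, mul_comm γ, mul_comm _ (2 : ℝ≥0∞),
      ENNReal.mul_div_cancel (by simp) (by simp)]

end Joint

/-! ### Output laws of equiprobable families of codewords. -/

section Mixture

variable {Ω X Z K : Type*} [MeasurableSpace Z] [Fintype K]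

/-- Output law when the input word is equiprobable on a finite family. -/
noncomputable def mixture (W : X → Measure Z) (x : K → X) : Measure Z :=
  (Fintype.card K : ℝ≥0∞)⁻¹ • ∑ k, W (x k)

theorem mixture_apply (W : X → Measure Z) (x : K → X) (B : Set Z) :
    mixture W x B = (Fintype.card K : ℝ≥0∞)⁻¹ * ∑ k, W (x k) B := by
  simp [mixture]

/-- The same soft covering bound serves twice: with `K = Fin L` for one message, and with `K = Fin M
× Fin L` for the whole codebook. -/
theorem messageLaw_eq_mixture (W : X → Measure Z) {M L : ℕ} (c : Fin M → Fin L → X) (m : Fin M) :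
    messageLaw W c m = mixture W (c m) := by
  simp [mixture, messageLaw]

instance [Nonempty K] (W : X → Measure Z) [∀ x, IsProbabilityMeasure (W x)] (x : K → X) :
    IsProbabilityMeasure (mixture W x) := ⟨by
  rw [mixture_apply]
  simp [ENNReal.inv_mul_cancel]⟩

variable [MeasurableSpace Ω] [MeasurableSpace X]

theorem mixture_eq_withDensity {W : X → Measure Z} {x : K → X} {ρ : Measure Z}
    {U : X × Z → ℝ≥0∞} (hU : Measurable U)
    (h : ∀ k, W (x k) = ρ.withDensity fun z => U (x k, z)) :
    mixture W x = ρ.withDensity fun z => (Fintype.card K : ℝ≥0∞)⁻¹ * ∑ k, U (x k, z) := by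
  have hm : ∀ k, Measurable fun z => U (x k, z) := fun k => by fun_prop
  ext B hB
  rw [mixture_apply, withDensity_apply _ hB, lintegral_const_mul _ (by fun_prop),
    lintegral_finsetSum _ fun k _ => hm k]
  congr 1
  refine Finset.sum_congr rfl fun k _ => ?_
  rw [h k, withDensity_apply _ hB]

theorem measurable_mixture (W : Kernel X Z) [IsMarkovKernel W] {C : K → Ω → X}
    (hC : ∀ k, Measurable (C k)) {G : Set (Ω × Z)} (hG : MeasurableSet G) :
    Measurable fun ω => mixture W (fun k => C k ω) (Prod.mk ω ⁻¹' G) := by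
  simp_rw [mixture_apply]
  exact (Finset.measurable_sum _ fun k _ => measurable_kernel_comap W (hC k) hG).const_mul _

theorem lintegral_mixture_le [Nonempty K] (μ : Measure Ω) [IsProbabilityMeasure μ]
    (W : Kernel X Z) [IsMarkovKernel W] {C : K → Ω → X} (hC : ∀ k, Measurable (C k))
    {G : Set (Ω × Z)} (hG : MeasurableSet G) {b : ℝ≥0∞}
    (hb : ∀ k, (μ ⊗ₘ W.comap (C k) (hC k)) G ≤ b) :
    ∫⁻ ω, mixture W (fun k => C k ω) (Prod.mk ω ⁻¹' G) ∂μ ≤ b := by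
  simp_rw [mixture_apply]
  rw [lintegral_const_mul _ (Finset.measurable_sum _ fun k _ => measurable_kernel_comap W (hC k) hG),
    lintegral_finsetSum _ fun k _ => measurable_kernel_comap W (hC k) hG]
  simp_rw [lintegral_kernel_comap μ W (hC _) hG]
  calc _ ≤ (Fintype.card K : ℝ≥0∞)⁻¹ * ∑ _k : K, b := by gcongr; exact hb _
    _ = b := by
      rw [Finset.sum_const, Finset.card_univ, nsmul_eq_mul, ← mul_assoc,
        ENNReal.inv_mul_cancel (by simp) (by simp), one_mul]

theorem lintegral_mixture_soft_covering_le [Nonempty K] (μ : Measure Ω) [IsProbabilityMeasure μ]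
    (W : Kernel X Z) [IsMarkovKernel W] {C : K → Ω → X} (hC : ∀ k, Measurable (C k))
    {q : Measure X} [IsProbabilityMeasure q] (hev : ∀ k, μ.map (C k) = q)
    (hpair : ∀ k k', k ≠ k' → μ.map (fun ω => (C k ω, C k' ω)) = q.prod q)
    {U : X × Z → ℝ≥0∞} (hU : Measurable U) (hU1 : ∀ z, ∫⁻ x, U (x, z) ∂q ≤ 1)
    {t γ : ℝ≥0∞} (hγ0 : γ ≠ 0) (hγ : γ ≠ ∞) (ht : 2 * t ≤ γ * Fintype.card K) :
    ∫⁻ ω, mixture W (fun k => C k ω) {z | γ < (Fintype.card K : ℝ≥0∞)⁻¹ * ∑ k, U (C k ω, z)} ∂μ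
      ≤ (q ⊗ₘ W) {p | t < U p} + 2 / γ := by
  have hset : ∀ ω, {z | γ < (Fintype.card K : ℝ≥0∞)⁻¹ * ∑ k, U (C k ω, z)} =
      Prod.mk ω ⁻¹' {p : Ω × Z | γ * Fintype.card K < ∑ j, U (C j p.1, p.2)} := fun ω => by
    ext z
    simp only [Set.mem_ofPred_eq, Set.mem_preimage]
    rw [mul_comm _ (∑ k, U (C k ω, z)), ← div_eq_mul_inv,
      ENNReal.lt_div_iff_mul_lt (by simp) (by simp)]
  simp_rw [hset]
  exact lintegral_mixture_le μ W hC (measurableSet_lt (by fun_prop) (by fun_prop))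
    fun k => soft_covering μ W hC hev hpair hU hU1 hγ0 hγ ht k

theorem measurable_mixture_gt (W : Kernel X Z) [IsMarkovKernel W] {C : K → Ω → X}
    (hC : ∀ k, Measurable (C k)) {U : X × Z → ℝ≥0∞} (hU : Measurable U) (γ : ℝ≥0∞) :
    Measurable fun ω => mixture W (fun k => C k ω)
      {z | γ < (Fintype.card K : ℝ≥0∞)⁻¹ * ∑ k, U (C k ω, z)} :=
  measurable_mixture W hC
    (G := {p : Ω × Z | γ < (Fintype.card K : ℝ≥0∞)⁻¹ * ∑ k, U (C k p.1, p.2)})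
    (measurableSet_lt measurable_const (by fun_prop))

theorem withDensity_inter_le {ρ : Measure Z} {u : Z → ℝ≥0∞} (hu : Measurable u) (γ : ℝ≥0∞)
    {B : Set Z} (hB : MeasurableSet B) : ρ.withDensity u (B ∩ {z | u z ≤ γ}) ≤ γ * ρ B := by
  have hm : MeasurableSet (B ∩ {z | u z ≤ γ}) := hB.inter (measurableSet_le hu measurable_const)
  rw [withDensity_apply _ hm]
  calc _ ≤ ∫⁻ _ in B ∩ {z | u z ≤ γ}, γ ∂ρ := setLIntegral_mono measurable_const fun z hz => hz.2
    _ = γ * ρ (B ∩ {z | u z ≤ γ}) := setLIntegral_const _ _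
    _ ≤ γ * ρ B := by gcongr; exact Set.inter_subset_left

/-- Change of measure: split `B` according to whether the density exceeds `γ`. -/
theorem measure_le_add_mul (μ ρ : Measure Z) {u : Z → ℝ≥0∞}
    (hu : Measurable u) (h : μ = ρ.withDensity u) (γ : ℝ≥0∞) {B : Set Z} (hB : MeasurableSet B) :
    μ B ≤ μ {z | γ < u z} + γ * ρ B := by
  have hsub : B ⊆ {z | γ < u z} ∪ B ∩ {z | u z ≤ γ} := fun z hz => by
    by_cases h : γ < u z
    · exact Or.inl h
    · exact Or.inr ⟨hz, not_lt.1 h⟩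
  refine (measure_mono hsub).trans ((measure_union_le _ _).trans (add_le_add le_rfl ?_))
  nth_rw 1 [h]
  exact withDensity_inter_le hu γ hB

end Mixture

/-! ### Converse bounds for a single use of the channel. -/

section OneShotConverse

variable {X Z : Type*} [MeasurableSpace Z]

/-- `B m` is the event that `m` is listed. Each observation lies in as many of these events as its
list has members, whence total mass at most `T` under any law `ρ`; their union avoids the
declaration of no message, whence the bound under `π`. -/
theorem CanDecode.exists_events {W : X → Measure Z} [∀ x, IsProbabilityMeasure (W x)]
    {π : Measure Z} [IsProbabilityMeasure π] {M L : ℕ} [NeZero M] [NeZero L]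
    {c : Fin M → Fin L → X} {A : ℝ} {T : ℕ} {ε : ℝ} (h : CanDecode W π c A T ε) :
    ∃ B : Fin M → Set Z, (∀ m, MeasurableSet (B m)) ∧ π (⋃ m, B m) ≤ ENNReal.ofReal A⁻¹ ∧
      (∀ ρ : Measure Z, IsProbabilityMeasure ρ → ∑ m, ρ (B m) ≤ T) ∧
      ENNReal.ofReal ε ≤ (M : ℝ≥0∞)⁻¹ * ∑ m, mixture W (c m) (B m) := by
  classical
  obtain ⟨d, hT, hA, e, he, hε⟩ := h
  set B : Fin M → Set Z := fun m => {z | ∃ s, d.decode z = some s ∧ m ∈ s}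
  have hB : ∀ m, MeasurableSet (B m) := fun m => by
    have : B m = ⋃ s ∈ {s : Finset (Fin M) | m ∈ s}, d.decode ⁻¹' {some s} := by
      ext z; simp [B, and_comm]
    rw [this]
    exact MeasurableSet.biUnion (Set.to_countable _) fun s _ => d.measurableSet_fiber _
  refine ⟨B, hB, ?_, ?_, ?_⟩
  · have hN : MeasurableSet {z | d.decode z = none} := d.measurableSet_fiber none
    have hsub : (⋃ m, B m) ⊆ {z | d.decode z = none}ᶜ := by
      intro z hz
      simp only [Set.mem_iUnion] at hz
      obtain ⟨m, s, hs, -⟩ := hz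
      simp [hs]
    refine (measure_mono hsub).trans ?_
    rw [← ENNReal.ofReal_toReal (measure_ne_top π _)]
    refine ENNReal.ofReal_le_ofReal ?_
    have := probReal_compl_eq_one_sub (μ := π) hN
    change π.real _ ≤ _
    linarith
  · intro ρ _
    have h1 : ∑ m, ρ (B m) = ∫⁻ z, ∑ m, (B m).indicator 1 z ∂ρ := by
      rw [lintegral_finsetSum _ fun m _ => measurable_one.indicator (hB m)]
      exact Finset.sum_congr rfl fun m _ => (lintegral_indicator_one (hB m)).symm
    rw [h1]
    calc _ ≤ ∫⁻ _, (T : ℝ≥0∞) ∂ρ := lintegral_mono fun z => ?_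
      _ = T := by simp
    have h2 : ∑ m, (B m).indicator (1 : Z → ℝ≥0∞) z = (Finset.univ.filter fun m => z ∈ B m).card := by
      rw [Finset.card_filter, Nat.cast_sum]
      refine Finset.sum_congr rfl fun m _ => ?_
      by_cases hm : z ∈ B m <;> simp [hm]
    rw [h2]
    rcases Option.eq_none_or_eq_some (d.decode z) with hd | ⟨s, hd⟩
    · have : (Finset.univ.filter fun m => z ∈ B m) = ∅ := by
        ext m; simp [B, hd]
      rw [this]; simp
    · have : (Finset.univ.filter fun m => z ∈ B m) = s := by
        ext m; simp [B, hd]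
      rw [this]
      exact Nat.cast_le.2 (hT z s hd)
  · have hM : (0 : ℝ) < M := by exact_mod_cast Nat.pos_of_ne_zero (NeZero.ne M)
    have h1 : ε ≤ (M : ℝ)⁻¹ * ∑ m, (mixture W (c m)).real (B m) := by
      rw [hε, div_eq_inv_mul]
      gcongr with m _
      rw [← messageLaw_eq_mixture]
      exact he m
    refine (ENNReal.ofReal_le_ofReal h1).trans (le_of_eq ?_)
    rw [ENNReal.ofReal_mul (by positivity), ENNReal.ofReal_inv_of_pos hM, ENNReal.ofReal_natCast,
      ENNReal.ofReal_sum_of_nonneg fun _ _ => measureReal_nonneg]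
    congr 1
    exact Finset.sum_congr rfl fun m _ => ENNReal.ofReal_toReal (measure_ne_top _ _)

variable [MeasurableSpace X]

theorem ae_all_codewords (q : Measure X) [IsProbabilityMeasure q] {M L : ℕ} {p : X → Prop}
    (h : ∀ᵐ x ∂q, p x) :
    ∀ᵐ c ∂(Measure.pi fun _ : Fin M => Measure.pi fun _ : Fin L => q), ∀ m l, p (c m l) :=
  ae_all_iff.2 fun m => ae_all_iff.2 fun l =>
    ((measurePreserving_eval (fun _ : Fin L => q) l).comp
      (measurePreserving_eval (fun _ : Fin M => Measure.pi fun _ : Fin L => q) m)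
      ).quasiMeasurePreserving.ae h

theorem mul_measure_le_lintegral {Ω : Type*} [MeasurableSpace Ω] {μ : Measure Ω} {S : Set Ω}
    (hS : MeasurableSet S) {e : ℝ≥0∞} {f : Ω → ℝ≥0∞} (h : ∀ᵐ ω ∂μ, ω ∈ S → e ≤ f ω) :
    e * μ S ≤ ∫⁻ ω, f ω ∂μ := by
  rw [← setLIntegral_const]
  exact (lintegral_mono_ae ((ae_restrict_iff' hS).2 h)).trans (setLIntegral_le_lintegral _ _)

/-- Each message law is dominated by `γ` times `W ∘ₘ q` up to its soft covering defect. Averaging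
over messages leaves `γ T / M`, and averaging over codebooks controls the defects. -/
theorem one_shot_list_converse (q : Measure X) [IsProbabilityMeasure q] (W : Kernel X Z)
    [IsMarkovKernel W] (π : Measure Z) [IsProbabilityMeasure π]
    {U : X × Z → ℝ≥0∞} (hU : Measurable U) (hU1 : ∀ z, ∫⁻ x, U (x, z) ∂q ≤ 1)
    (hWU : ∀ᵐ x ∂q, W x = (W ∘ₘ q).withDensity fun z => U (x, z))
    {M L : ℕ} [NeZero M] [NeZero L] {A : ℝ} {T : ℕ} {ε : ℝ} {t γ : ℝ≥0∞} (hγ0 : γ ≠ 0)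
    (hγ : γ ≠ ∞) (ht : 2 * t ≤ γ * L) {S : Set (Fin M → Fin L → X)} (hS : MeasurableSet S)
    (hSd : ∀ c ∈ S, CanDecode W π c A T ε) :
    ENNReal.ofReal ε * (Measure.pi fun _ : Fin M => Measure.pi fun _ : Fin L => q) S
      ≤ (q ⊗ₘ W) {p | t < U p} + 2 / γ + γ * T / M := by
  set μ := Measure.pi fun _ : Fin M => Measure.pi fun _ : Fin L => q
  have hM0 : (M : ℝ≥0∞) ≠ 0 := by simp [NeZero.ne M]
  set bad : Fin M → (Fin M → Fin L → X) → ℝ≥0∞ := fun m c =>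
    mixture W (c m) {z | γ < (Fintype.card (Fin L) : ℝ≥0∞)⁻¹ * ∑ l, U (c m l, z)}
  have hCm : ∀ (m : Fin M) (l : Fin L), Measurable fun c : Fin M → Fin L → X => c m l :=
    fun m l => (measurable_pi_apply l).comp (measurable_pi_apply m)
  have hbadm : ∀ m, Measurable (bad m) := by
    intro m
    exact measurable_mixture_gt W (C := fun l (c : Fin M → Fin L → X) => c m l) (hCm m) hU γ
  have hbad : ∀ m, ∫⁻ c, bad m c ∂μ ≤ (q ⊗ₘ W) {p | t < U p} + 2 / γ := fun m =>
    lintegral_mixture_soft_covering_le μ W (C := fun l (c : Fin M → Fin L → X) => c m l) (hCm m)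
      (fun l => map_eval_pi_pi q m l)
      (fun l l' hl => map_pair_pi_pi q (k := (m, l)) (k' := (m, l')) (by simpa using hl))
      hU hU1 hγ0 hγ (by simpa using ht)
  refine (mul_measure_le_lintegral (f := fun c => (M : ℝ≥0∞)⁻¹ * ∑ m, bad m c + γ * T / M) hS ?_).trans
    ?_
  · filter_upwards [ae_all_codewords q hWU] with c hc hcS
    obtain ⟨B, hB, -, hBT, hε⟩ := (hSd c hcS).exists_events
    refine hε.trans ?_
    calc _ ≤ (M : ℝ≥0∞)⁻¹ * ∑ m, (bad m c + γ * (W ∘ₘ q) (B m)) := by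
          gcongr with m _
          exact measure_le_add_mul _ _ (by fun_prop) (mixture_eq_withDensity hU (hc m)) γ (hB m)
      _ = (M : ℝ≥0∞)⁻¹ * ∑ m, bad m c + (M : ℝ≥0∞)⁻¹ * (γ * ∑ m, (W ∘ₘ q) (B m)) := by
          rw [Finset.sum_add_distrib, mul_add, Finset.mul_sum (f := fun m => (W ∘ₘ q) (B m))]
      _ ≤ (M : ℝ≥0∞)⁻¹ * ∑ m, bad m c + (M : ℝ≥0∞)⁻¹ * (γ * T) := by
          gcongr
          exact hBT _ inferInstance
      _ = _ := by rw [ENNReal.div_eq_inv_mul]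
  · rw [lintegral_add_right _ measurable_const, lintegral_const, measure_univ, mul_one,
      lintegral_const_mul _ (Finset.measurable_sum _ fun m _ => hbadm m),
      lintegral_finsetSum _ fun m _ => hbadm m]
    gcongr
    calc _ ≤ (M : ℝ≥0∞)⁻¹ * ∑ _m : Fin M, ((q ⊗ₘ W) {p | t < U p} + 2 / γ) := by
          gcongr with m _; exact hbad m
      _ = _ := by
          rw [Finset.sum_const, Finset.card_univ, Fintype.card_fin, nsmul_eq_mul, ← mul_assoc,
            ENNReal.inv_mul_cancel hM0 (by simp), one_mul]

/-- Success for any message implies that some message is declared, so the mixture over all `M L`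
codewords gives the declaration event at least the average success probability. Two changes of
measure, at costs `γ` and `θ`, carry that event to `π`, where its mass is at most `1 / A`. -/
theorem one_shot_detection_converse (q : Measure X) [IsProbabilityMeasure q] (W : Kernel X Z)
    [IsMarkovKernel W] (π : Measure Z) [IsProbabilityMeasure π]
    {U : X × Z → ℝ≥0∞} (hU : Measurable U) (hU1 : ∀ z, ∫⁻ x, U (x, z) ∂q ≤ 1)
    (hWU : ∀ᵐ x ∂q, W x = (W ∘ₘ q).withDensity fun z => U (x, z))
    {V : Z → ℝ≥0∞} (hV : Measurable V) (hVπ : W ∘ₘ q = π.withDensity V)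
    {M L : ℕ} [NeZero M] [NeZero L] {A : ℝ} {T : ℕ} {ε : ℝ} {t γ θ : ℝ≥0∞} (hγ0 : γ ≠ 0)
    (hγ : γ ≠ ∞) (ht : 2 * t ≤ γ * (M * L)) {S : Set (Fin M → Fin L → X)} (hS : MeasurableSet S)
    (hSd : ∀ c ∈ S, CanDecode W π c A T ε) :
    ENNReal.ofReal ε * (Measure.pi fun _ : Fin M => Measure.pi fun _ : Fin L => q) S
      ≤ (q ⊗ₘ W) {p | t < U p} + 2 / γ + (W ∘ₘ q) {z | θ < V z}
        + γ * θ * ENNReal.ofReal A⁻¹ := by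
  set μ := Measure.pi fun _ : Fin M => Measure.pi fun _ : Fin L => q
  set K := Fin M × Fin L
  have hCm : ∀ k : K, Measurable fun c : Fin M → Fin L → X => c k.1 k.2 :=
    fun k => (measurable_pi_apply k.2).comp (measurable_pi_apply k.1)
  have hcard : (Fintype.card K : ℝ≥0∞) = M * L := by simp [K]
  set mix : (Fin M → Fin L → X) → Measure Z := fun c => mixture W fun k : K => c k.1 k.2
  set bad : (Fin M → Fin L → X) → ℝ≥0∞ := fun c =>
    mix c {z | γ < (Fintype.card K : ℝ≥0∞)⁻¹ * ∑ k : K, U (c k.1 k.2, z)}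
  have hbadm : Measurable bad := by
    exact measurable_mixture_gt W (C := fun (k : K) (c : Fin M → Fin L → X) => c k.1 k.2) hCm hU γ
  have hbad : ∫⁻ c, bad c ∂μ ≤ (q ⊗ₘ W) {p | t < U p} + 2 / γ :=
    lintegral_mixture_soft_covering_le μ W (C := fun (k : K) (c : Fin M → Fin L → X) => c k.1 k.2) hCm
      (fun k => map_eval_pi_pi q k.1 k.2) (fun k k' hk => map_pair_pi_pi q hk)
      hU hU1 hγ0 hγ (by rw [hcard]; exact ht)
  have hVs : MeasurableSet {z | θ < V z} := measurableSet_lt measurable_const hV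
  have hG : MeasurableSet {p : (Fin M → Fin L → X) × Z | θ < V p.2} := measurable_snd hVs
  -- Averaged over codebooks, the mixture is exactly `W ∘ₘ q`.
  have hv : ∫⁻ c, mix c {z | θ < V z} ∂μ ≤ (W ∘ₘ q) {z | θ < V z} := by
    refine lintegral_mixture_le μ W (C := fun (k : K) (c : Fin M → Fin L → X) => c k.1 k.2) hCm hG fun k => le_of_eq ?_
    rw [← Measure.snd_compProd q W, ← map_eval_pi_pi q k.1 k.2, ← map_compProd_comap μ W (hCm k),
      Measure.snd_apply hVs, Measure.map_apply (by fun_prop) (measurable_snd hVs)]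
    rfl
  refine (mul_measure_le_lintegral
    (f := fun c => bad c + mix c {z | θ < V z} + γ * θ * ENNReal.ofReal A⁻¹) hS ?_).trans ?_
  · filter_upwards [ae_all_codewords q hWU] with c hc hcS
    obtain ⟨B, hB, hBA, -, hε⟩ := (hSd c hcS).exists_events
    set D := ⋃ m, B m
    have hD : MeasurableSet D := MeasurableSet.iUnion hB
    have h1 : (M : ℝ≥0∞)⁻¹ * ∑ m, mixture W (c m) (B m) ≤ mix c D := by
      simp only [mix, mixture_apply]
      rw [hcard, Fintype.card_fin, Fintype.sum_prod_type, ← Finset.mul_sum, ← mul_assoc,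
        ENNReal.mul_inv (by simp) (by simp)]
      gcongr with m _ l _
      exact Set.subset_iUnion B m
    have h2 : mix c D ≤ mix c (D ∩ {z | V z ≤ θ}) + mix c {z | θ < V z} := by
      refine (measure_mono fun z hz => ?_).trans (measure_union_le _ _)
      by_cases h : θ < V z
      · exact Or.inr h
      · exact Or.inl ⟨hz, not_lt.1 h⟩
    have h3 : mix c (D ∩ {z | V z ≤ θ}) ≤ bad c + γ * (W ∘ₘ q) (D ∩ {z | V z ≤ θ}) :=
      measure_le_add_mul _ _ (by fun_prop)
        (mixture_eq_withDensity hU fun k : K => hc k.1 k.2) γ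
        (hD.inter (measurableSet_le hV measurable_const))
    have h4 : (W ∘ₘ q) (D ∩ {z | V z ≤ θ}) ≤ θ * ENNReal.ofReal A⁻¹ := by
      rw [hVπ]
      exact (withDensity_inter_le hV θ hD).trans (by gcongr)
    calc _ ≤ mix c D := hε.trans h1
      _ ≤ bad c + γ * (θ * ENNReal.ofReal A⁻¹) + mix c {z | θ < V z} :=
          h2.trans (by gcongr; exact h3.trans (by gcongr))
      _ = _ := by ring
  · rw [lintegral_add_right _ measurable_const, lintegral_const, measure_univ, mul_one,
      lintegral_add_left hbadm]
    gcongr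

end OneShotConverse

/-! ### The threshold list decoder for a fixed codebook. -/

section Decoder

variable {X Z : Type*} {M L : ℕ}

open Classical in
/-- Messages with a codeword whose density against the observation is at least `θ`. -/
noncomputable def candidates (U : X × Z → ℝ≥0∞) (θ : ℝ≥0∞) (c : Fin M → Fin L → X) (z : Z) :
    Finset (Fin M) :=
  Finset.univ.filter fun m => ∃ l, θ ≤ U (c m l, z)

theorem mem_candidates {U : X × Z → ℝ≥0∞} {θ : ℝ≥0∞} {c : Fin M → Fin L → X} {z : Z} {m : Fin M} :
    m ∈ candidates U θ c z ↔ ∃ l, θ ≤ U (c m l, z) := by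
  simp [candidates]

/-- Strictly fewer than `T` wrong candidates leave room for `m₀` itself. -/
theorem card_candidates_le_of_sum_lt {M L T : ℕ} {U : X × Z → ℝ≥0∞} {θU : ℝ≥0∞} (c : Fin M → Fin L → X)
    (z : Z) (m₀ : Fin M)
    (h : ∑ m ∈ Finset.univ.erase m₀, {p : (Fin M → Fin L → X) × Z |
          ∃ l, θU ≤ U (p.1 m l, p.2)}.indicator 1 (c, z) < (T : ℝ≥0∞)) :
    (candidates U θU c z).card ≤ T := by
  classical
  have h1 : ∑ m ∈ Finset.univ.erase m₀, {p : (Fin M → Fin L → X) × Z |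
        ∃ l, θU ≤ U (p.1 m l, p.2)}.indicator (1 : (Fin M → Fin L → X) × Z → ℝ≥0∞) (c, z)
      = (((candidates U θU c z).erase m₀).card : ℝ≥0∞) := by
    have h2 : (candidates U θU c z).erase m₀
        = (Finset.univ.erase m₀).filter fun m => ∃ l, θU ≤ U (c m l, z) := by
      ext m; simp [mem_candidates]
    rw [h2, Finset.card_filter, Nat.cast_sum]
    refine Finset.sum_congr rfl fun m _ => ?_
    by_cases hm : ∃ l, θU ≤ U (c m l, z)
    · rw [Set.indicator_of_mem (by exact hm), if_pos hm]; simp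
    · rw [Set.indicator_of_notMem (by exact hm), if_neg hm]; simp
  rw [h1, Nat.cast_lt] at h
  have := Finset.pred_card_le_card_erase (s := candidates U θU c z) (a := m₀)
  omega

variable [MeasurableSpace X] [MeasurableSpace Z]

open Classical in
/-- The threshold decoder: the candidates are listed if the observation passes the detection test
and there are between `1` and `T` of them. -/
noncomputable def thresholdDecoder {U : X × Z → ℝ≥0∞} (hU : Measurable U) {V : Z → ℝ≥0∞}
    (hV : Measurable V) (θU θV : ℝ≥0∞) (T : ℕ) (c : Fin M → Fin L → X) : ListDecoder Z M where
  decode z := if θV ≤ V z then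
    (if (candidates U θU c z).Nonempty ∧ (candidates U θU c z).card ≤ T then
      some (candidates U θU c z) else none) else none
  measurableSet_fiber o := by
    -- With discrete σ-algebras on the finite sets of lists and outputs, only the measurability of
    -- `candidates` needs an argument.
    let _ : MeasurableSpace (Finset (Fin M)) := ⊤
    let _ : MeasurableSpace (Option (Finset (Fin M))) := ⊤
    have hs : Measurable (candidates U θU c) := by
      refine measurable_to_countable' fun s => ?_
      have : candidates U θU c ⁻¹' {s} = ⋂ m, {z | (∃ l, θU ≤ U (c m l, z)) ↔ m ∈ s} := by
        ext z
        simp only [Set.mem_preimage, Set.mem_singleton_iff, Set.mem_iInter, Set.mem_ofPred_eq,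
          Finset.ext_iff, mem_candidates]
      rw [this]
      refine MeasurableSet.iInter fun m => ?_
      have h1 : MeasurableSet {z | ∃ l, θU ≤ U (c m l, z)} := by
        rw [Set.ofPred_exists]
        exact MeasurableSet.iUnion fun l => measurableSet_le measurable_const (by fun_prop)
      by_cases hm : m ∈ s
      · simpa only [hm, iff_true] using h1
      · simp only [hm, iff_false]
        exact h1.compl
    have hg : Measurable fun s : Finset (Fin M) =>
        (if s.Nonempty ∧ s.card ≤ T then some s else none : Option (Finset (Fin M))) :=
      measurable_from_top
    exact Measurable.ite (measurableSet_le measurable_const hV) (hg.comp hs) measurable_const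
      (MeasurableSpace.measurableSet_top (s := {o}))

theorem canDecode_of_average_failure_le (W : X → Measure Z) [∀ x, IsProbabilityMeasure (W x)]
    (π : Measure Z) [IsProbabilityMeasure π] {U : X × Z → ℝ≥0∞} (hU : Measurable U)
    {V : Z → ℝ≥0∞} (hV : Measurable V) (θU θV : ℝ≥0∞) (T : ℕ) (c : Fin M → Fin L → X)
    [NeZero M] [NeZero L] {A : ℝ} (hA : 0 < A) {ε : ℝ}
    (hπ : π {z | θV ≤ V z ∧ ∃ m l, θU ≤ U (c m l, z)} ≤ ENNReal.ofReal A⁻¹)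
    (G : Fin M → Fin L → Set Z)
    (hG : ∀ m l z, z ∉ G m l → θV ≤ V z ∧ θU ≤ U (c m l, z) ∧ (candidates U θU c z).card ≤ T)
    (hfail : (M * L : ℝ)⁻¹ * ∑ m, ∑ l, (W (c m l)).real (G m l) ≤ 1 - ε) :
    CanDecode W π c A T ε := by
  classical
  set d := thresholdDecoder hU hV θU θV T c
  have hM : (0 : ℝ) < M := by exact_mod_cast Nat.pos_of_ne_zero (NeZero.ne M)
  have hL : (0 : ℝ) < L := by exact_mod_cast Nat.pos_of_ne_zero (NeZero.ne L)
  have hdec : ∀ z, d.decode z = if θV ≤ V z then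
    (if (candidates U θU c z).Nonempty ∧ (candidates U θU c z).card ≤ T then
      some (candidates U θU c z) else none) else none := fun z => rfl
  set p : Fin M → ℝ := fun m => (messageLaw W c m).real {z | ∃ s, d.decode z = some s ∧ m ∈ s}
  have hp : ∀ m, (L : ℝ)⁻¹ * ∑ l, (1 - (W (c m l)).real (G m l)) ≤ p m := fun m => by
    simp only [p, Measure.real]
    rw [messageLaw_eq_mixture, mixture_apply, ENNReal.toReal_mul,
      ENNReal.toReal_sum fun _ _ => measure_ne_top _ _]
    simp only [Fintype.card_fin, ENNReal.toReal_inv, ENNReal.toReal_natCast]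
    gcongr with l _
    have h1 : (Set.univ : Set Z) ⊆ G m l ∪ {z | ∃ s, d.decode z = some s ∧ m ∈ s} := by
      intro z _
      by_cases hz : z ∈ G m l
      · exact Or.inl hz
      · obtain ⟨h1, h2, h3⟩ := hG m l z hz
        have hmem : m ∈ candidates U θU c z := mem_candidates.2 ⟨l, h2⟩
        refine Or.inr ⟨candidates U θU c z, ?_, hmem⟩
        rw [hdec, if_pos h1, if_pos ⟨⟨m, hmem⟩, h3⟩]
    have h2 := (measureReal_mono (μ := W (c m l)) h1).trans (measureReal_union_le _ _)
    rw [probReal_univ] at h2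
    simp only [Measure.real] at h2
    linarith
  have havg : ε ≤ (∑ m, p m) / M := by
    have h1 : ∑ m, ((L : ℝ)⁻¹ * ∑ l, (1 - (W (c m l)).real (G m l))) ≤ ∑ m, p m :=
      Finset.sum_le_sum fun m _ => hp m
    have h2 : ∑ m, ((L : ℝ)⁻¹ * ∑ l, (1 - (W (c m l)).real (G m l)))
        = M * (1 - (M * L : ℝ)⁻¹ * ∑ m, ∑ l, (W (c m l)).real (G m l)) := by
      simp only [Finset.sum_sub_distrib, Finset.sum_const, Finset.card_univ, Fintype.card_fin,
        nsmul_eq_mul, mul_one, mul_sub, ← Finset.mul_sum]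
      field_simp
    rw [le_div_iff₀ hM]
    calc ε * M ≤ M * (1 - (M * L : ℝ)⁻¹ * ∑ m, ∑ l, (W (c m l)).real (G m l)) := by
          rw [mul_comm]; gcongr; linarith
      _ ≤ _ := h2 ▸ h1
  -- The numbers `e m` must average to `ε` exactly, so the excess is subtracted uniformly; some may
  -- become negative, which `CanDecode` permits.
  refine ⟨d, fun z s hs => ?_, ?_, fun m => p m - ((∑ m, p m) / M - ε), fun m => ?_, ?_⟩
  · rw [hdec] at hs
    split_ifs at hs with h1 h2
    rw [← Option.some.inj hs]
    exact h2.2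
  · have hN : MeasurableSet {z | d.decode z = none} := d.measurableSet_fiber none
    have hsub : {z | d.decode z = none}ᶜ ⊆ {z | θV ≤ V z ∧ ∃ m l, θU ≤ U (c m l, z)} := by
      intro z hz
      simp only [Set.mem_compl_iff, Set.mem_ofPred_eq] at hz ⊢
      rw [hdec] at hz
      split_ifs at hz with h1 h2
      · obtain ⟨m, hm⟩ := h2.1
        exact ⟨h1, m, mem_candidates.1 hm⟩
      all_goals exact absurd rfl hz
    have h1 : π.real {z | d.decode z = none}ᶜ ≤ A⁻¹ :=
      ENNReal.toReal_le_of_le_ofReal (inv_nonneg.2 hA.le) ((measure_mono hsub).trans hπ)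
    rw [probReal_compl_eq_one_sub hN] at h1
    linarith
  · change _ ≤ p m
    linarith
  · rw [Finset.sum_sub_distrib]
    simp only [Finset.sum_const, Finset.card_univ, Fintype.card_fin, nsmul_eq_mul]
    field_simp
    ring

end Decoder

/-! ### Achievability for a single use of the channel. -/

section OneShotDirect

variable {X Z : Type*} [MeasurableSpace X] [MeasurableSpace Z]

theorem measure_exists_le {Ω ι : Type*} [MeasurableSpace Ω] [Fintype ι] (μ : Measure Ω)
    [IsProbabilityMeasure μ] {p : ι → Ω → Prop} {b : ℝ≥0∞} (h : ∀ i, μ {ω | p i ω} ≤ b) :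
    μ {ω | ∃ i, p i ω} ≤ min 1 (Fintype.card ι * b) := by
  refine le_min prob_le_one ?_
  rw [Set.ofPred_exists]
  refine (measure_iUnion_fintype_le _ _).trans ?_
  calc _ ≤ ∑ _i : ι, b := Finset.sum_le_sum fun i _ => h i
    _ = _ := by simp

/-- Without a message the observation is independent of the codebook. For fixed `z`, each codeword
passes with probability at most `θU⁻¹`; this bound multiplies the probability at most `θV⁻¹` of
passing the detection test. -/
theorem prod_false_alarm_le (q : Measure X) [IsProbabilityMeasure q]
    (π : Measure Z) [IsProbabilityMeasure π]
    {U : X × Z → ℝ≥0∞} (hU : Measurable U) (hU1 : ∀ z, ∫⁻ x, U (x, z) ∂q ≤ 1)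
    {V : Z → ℝ≥0∞} (hV : Measurable V) (hV1 : ∫⁻ z, V z ∂π ≤ 1) {M L : ℕ} {θU θV : ℝ≥0∞}
    (hθU0 : θU ≠ 0) (hθU : θU ≠ ∞) (hθV0 : θV ≠ 0) (hθV : θV ≠ ∞) :
    ∫⁻ c, π {z | θV ≤ V z ∧ ∃ m l, θU ≤ U (c m l, z)}
        ∂(Measure.pi fun _ : Fin M => Measure.pi fun _ : Fin L => q)
      ≤ θV⁻¹ * min 1 (M * L * θU⁻¹) := by
  set μ := Measure.pi fun _ : Fin M => Measure.pi fun _ : Fin L => q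
  set E : Set ((Fin M → Fin L → X) × Z) := {p | θV ≤ V p.2 ∧ ∃ k : Fin M × Fin L,
    θU ≤ U (p.1 k.1 k.2, p.2)}
  have hVs : MeasurableSet {z | θV ≤ V z} := measurableSet_le measurable_const hV
  have hE : MeasurableSet E := by
    refine MeasurableSet.inter (measurable_snd hVs) ?_
    change MeasurableSet {p : (Fin M → Fin L → X) × Z | ∃ k : Fin M × Fin L,
      θU ≤ U (p.1 k.1 k.2, p.2)}
    rw [Set.ofPred_exists]
    exact MeasurableSet.iUnion fun k => measurableSet_le measurable_const (by fun_prop)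
  have h1 : ∀ c : Fin M → Fin L → X, {z | θV ≤ V z ∧ ∃ m l, θU ≤ U (c m l, z)}
      = Prod.mk c ⁻¹' E := fun c => by
    ext z; simp [E, Prod.exists]
  simp_rw [h1]
  rw [← Measure.prod_apply hE, Measure.prod_apply_symm hE]
  have h2 : ∀ z, μ ((fun c => (c, z)) ⁻¹' E)
      ≤ {z | θV ≤ V z}.indicator (fun _ => min 1 (M * L * θU⁻¹)) z := fun z => by
    by_cases hz : θV ≤ V z
    · rw [Set.indicator_of_mem (by exact hz)]
      have h3 : ∀ k : Fin M × Fin L, μ {c | θU ≤ U (c k.1 k.2, z)} ≤ θU⁻¹ := fun k => by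
        have hm : Measurable fun x => U (x, z) := by fun_prop
        have h4 : μ {c | θU ≤ U (c k.1 k.2, z)} = q {x | θU ≤ U (x, z)} := by
          conv_rhs => rw [← map_eval_pi_pi q k.1 k.2]
          rw [Measure.map_apply (by fun_prop) (measurableSet_le measurable_const hm)]
          rfl
        rw [h4]
        refine (meas_ge_le_lintegral_div hm.aemeasurable hθU0 hθU).trans ?_
        rw [← one_div]
        exact ENNReal.div_le_div_right (hU1 z) _
      refine (measure_mono fun c hc => ?_).trans ((measure_exists_le μ h3).trans (by simp))
      exact hc.2
    · rw [Set.indicator_of_notMem (by exact hz)]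
      refine (measure_mono_null (fun c hc => ?_) measure_empty).le
      exact hz hc.1
  refine (lintegral_mono h2).trans ?_
  rw [lintegral_indicator_const hVs, mul_comm]
  gcongr
  refine (meas_ge_le_lintegral_div hV.aemeasurable hθV0 hθV).trans ?_
  rw [← one_div]
  exact ENNReal.div_le_div_right hV1 _

/-- Union bound over the three ways in which the threshold decoder fails on the codeword `k`. -/
theorem compProd_failure_le (q : Measure X) [IsProbabilityMeasure q] (W : Kernel X Z)
    [IsMarkovKernel W]
    {U : X × Z → ℝ≥0∞} (hU : Measurable U) (hU1 : ∀ z, ∫⁻ x, U (x, z) ∂q ≤ 1)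
    {V : Z → ℝ≥0∞} (hV : Measurable V) {M L : ℕ} {θU θV : ℝ≥0∞}
    (hθU0 : θU ≠ 0) (hθU : θU ≠ ∞) {T : ℕ} (hT : T ≠ 0) (k : Fin M × Fin L)
    (hk : Measurable fun c : Fin M → Fin L → X => c k.1 k.2) :
    ((Measure.pi fun _ : Fin M => Measure.pi fun _ : Fin L => q) ⊗ₘ W.comap _ hk)
      {p | V p.2 < θV ∨ U (p.1 k.1 k.2, p.2) < θU ∨ (T : ℝ≥0∞) ≤
        ∑ m ∈ Finset.univ.erase k.1, {p : (Fin M → Fin L → X) × Z |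
          ∃ l, θU ≤ U (p.1 m l, p.2)}.indicator 1 p}
      ≤ (W ∘ₘ q) {z | V z < θV} + (q ⊗ₘ W) {p | U p < θU} + M * min 1 (L * θU⁻¹) / T := by
  set μ := Measure.pi fun _ : Fin M => Measure.pi fun _ : Fin L => q
  set J := μ ⊗ₘ W.comap _ hk
  set D : Fin M → Set ((Fin M → Fin L → X) × Z) := fun m => {p | ∃ l, θU ≤ U (p.1 m l, p.2)}
  have hD : ∀ m, MeasurableSet (D m) := fun m => by
    simp only [D]
    rw [Set.ofPred_exists]
    exact MeasurableSet.iUnion fun l => measurableSet_le measurable_const (by fun_prop)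
  have hev : μ.map (fun c => c k.1 k.2) = q := map_eval_pi_pi q k.1 k.2
  have hmap : J.map (fun p => (p.1 k.1 k.2, p.2)) = q ⊗ₘ W := by
    rw [map_compProd_comap μ W hk, hev]
  have hVs : MeasurableSet {z | V z < θV} := measurableSet_lt hV measurable_const
  have hUs : MeasurableSet {p | U p < θU} := measurableSet_lt hU measurable_const
  have hsub : {p : (Fin M → Fin L → X) × Z | V p.2 < θV ∨ U (p.1 k.1 k.2, p.2) < θU ∨ (T : ℝ≥0∞) ≤
        ∑ m ∈ Finset.univ.erase k.1, (D m).indicator 1 p}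
      ⊆ ({p | V p.2 < θV} ∪ {p | U (p.1 k.1 k.2, p.2) < θU}) ∪
        {p | (T : ℝ≥0∞) ≤ ∑ m ∈ Finset.univ.erase k.1, (D m).indicator 1 p} := by
    rintro p (h | h | h)
    · exact Or.inl (Or.inl h)
    · exact Or.inl (Or.inr h)
    · exact Or.inr h
  refine (measure_mono hsub).trans ((measure_union_le _ _).trans (add_le_add
    ((measure_union_le _ _).trans (add_le_add (le_of_eq ?_) (le_of_eq ?_))) ?_))
  · rw [← Measure.snd_compProd q W, ← hmap, Measure.snd_apply hVs,
      Measure.map_apply (by fun_prop) (measurable_snd hVs)]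
    rfl
  · rw [← hmap, Measure.map_apply (by fun_prop) hUs]
    rfl
  · have hTt : (T : ℝ≥0∞) ≠ ∞ := by simp
    have hT0 : (T : ℝ≥0∞) ≠ 0 := by simpa using hT
    have hi : ∀ m, Measurable ((D m).indicator (1 : (Fin M → Fin L → X) × Z → ℝ≥0∞)) :=
      fun m => measurable_one.indicator (hD m)
    refine (meas_ge_le_lintegral_div
      (Finset.measurable_sum _ fun m _ => hi m).aemeasurable hT0 hTt).trans ?_
    refine ENNReal.div_le_div_right ?_ _
    rw [lintegral_finsetSum _ fun m _ => hi m]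
    -- All codewords of another message are independent of the output; the cap by `1` is the source
    -- of the positive part in the list exponent.
    have hDm : ∀ m ∈ Finset.univ.erase k.1,
        ∫⁻ p, (D m).indicator 1 p ∂J ≤ min 1 (L * θU⁻¹) := by
      intro m hm
      rw [lintegral_indicator_one (hD m)]
      have h1 : ∀ l : Fin L, J {p | θU ≤ U (p.1 m l, p.2)} ≤ θU⁻¹ := fun l => by
        have hml : Measurable fun c : Fin M → Fin L → X => c m l :=
          (measurable_pi_apply l).comp (measurable_pi_apply m)
        refine (meas_ge_le_lintegral_div (by fun_prop) hθU0 hθU).trans ?_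
        rw [← one_div]
        refine ENNReal.div_le_div_right ?_ _
        refine lintegral_other_codeword_le μ W hk hml (map_pair_pi_pi q (k' := (m, l)) ?_) hU hU1
        intro h
        exact (Finset.ne_of_mem_erase hm) (congrArg Prod.fst h).symm
      exact (measure_exists_le J h1).trans (by simp)
    calc _ ≤ ∑ m ∈ Finset.univ.erase k.1, min 1 (L * θU⁻¹) := Finset.sum_le_sum hDm
      _ ≤ ∑ _m : Fin M, min 1 (L * θU⁻¹) :=
          Finset.sum_le_sum_of_subset (Finset.erase_subset _ _)
      _ = _ := by simp

/-- The good codebooks are those with false-alarm probability at most `A⁻¹` and average failure at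
most `1 - ε`. Markov's inequality over the codebook, applied to each quantity, gives the two terms.
-/
theorem one_shot_direct (q : Measure X) [IsProbabilityMeasure q] (W : Kernel X Z)
    [IsMarkovKernel W] (π : Measure Z) [IsProbabilityMeasure π]
    {U : X × Z → ℝ≥0∞} (hU : Measurable U) (hU1 : ∀ z, ∫⁻ x, U (x, z) ∂q ≤ 1)
    {V : Z → ℝ≥0∞} (hV : Measurable V) (hV1 : ∫⁻ z, V z ∂π ≤ 1) (M L : ℕ) [NeZero M] [NeZero L]
    {θU θV : ℝ≥0∞} (hθU0 : θU ≠ 0) (hθU : θU ≠ ∞) (hθV0 : θV ≠ 0) (hθV : θV ≠ ∞)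
    {A : ℝ} (hA : 0 < A) {T : ℕ} (hT : T ≠ 0) {ε : ℝ} (hε : ε < 1) :
    ∃ S : Set (Fin M → Fin L → X), MeasurableSet S ∧ (∀ c ∈ S, CanDecode W π c A T ε) ∧
      (Measure.pi fun _ : Fin M => Measure.pi fun _ : Fin L => q) Sᶜ
        ≤ ENNReal.ofReal A * (θV⁻¹ * min 1 (M * L * θU⁻¹)) +
          ((W ∘ₘ q) {z | V z < θV} + (q ⊗ₘ W) {p | U p < θU} + M * min 1 (L * θU⁻¹) / T)
            / ENNReal.ofReal (1 - ε) := by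
  set μ := Measure.pi fun _ : Fin M => Measure.pi fun _ : Fin L => q
  set f : (Fin M → Fin L → X) → ℝ≥0∞ := fun c => π {z | θV ≤ V z ∧ ∃ m l, θU ≤ U (c m l, z)}
  set G : Fin M × Fin L → Set ((Fin M → Fin L → X) × Z) := fun k =>
    {p | V p.2 < θV ∨ U (p.1 k.1 k.2, p.2) < θU ∨ (T : ℝ≥0∞) ≤
        ∑ m ∈ Finset.univ.erase k.1, {p : (Fin M → Fin L → X) × Z |
          ∃ l, θU ≤ U (p.1 m l, p.2)}.indicator 1 p}
  set g : (Fin M → Fin L → X) → ℝ≥0∞ := fun c =>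
    (M * L : ℝ≥0∞)⁻¹ * ∑ k : Fin M × Fin L, W (c k.1 k.2) (Prod.mk c ⁻¹' G k)
  set b := (W ∘ₘ q) {z | V z < θV} + (q ⊗ₘ W) {p | U p < θU} + M * min 1 (L * θU⁻¹) / T
  have hck : ∀ k : Fin M × Fin L, Measurable fun c : Fin M → Fin L → X => c k.1 k.2 :=
    fun k => (measurable_pi_apply k.2).comp (measurable_pi_apply k.1)
  have hD : ∀ m, MeasurableSet {p : (Fin M → Fin L → X) × Z | ∃ l, θU ≤ U (p.1 m l, p.2)} :=
    fun m => by
      rw [Set.ofPred_exists]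
      exact MeasurableSet.iUnion fun l => measurableSet_le measurable_const (by fun_prop)
  have hf : Measurable f := by
    refine measurable_measure_prodMk_left (ν := π) (s := {p : (Fin M → Fin L → X) × Z |
      θV ≤ V p.2 ∧ ∃ m l, θU ≤ U (p.1 m l, p.2)}) ?_
    have h1 : MeasurableSet {p : (Fin M → Fin L → X) × Z | θV ≤ V p.2} :=
      measurableSet_le measurable_const (by fun_prop)
    refine h1.inter ?_
    change MeasurableSet {p : (Fin M → Fin L → X) × Z | ∃ m l, θU ≤ U (p.1 m l, p.2)}
    rw [Set.ofPred_exists]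
    exact MeasurableSet.iUnion hD
  have hGm : ∀ k, MeasurableSet (G k) := fun k => by
    have h1 : MeasurableSet {p : (Fin M → Fin L → X) × Z | V p.2 < θV} :=
      measurableSet_lt (by fun_prop) measurable_const
    have h2 : MeasurableSet {p : (Fin M → Fin L → X) × Z | U (p.1 k.1 k.2, p.2) < θU} :=
      measurableSet_lt (by fun_prop) measurable_const
    have h3 : Measurable fun p => ∑ m ∈ Finset.univ.erase k.1, {p : (Fin M → Fin L → X) × Z |
          ∃ l, θU ≤ U (p.1 m l, p.2)}.indicator (1 : (Fin M → Fin L → X) × Z → ℝ≥0∞) p :=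
      Finset.measurable_sum _ fun m _ => measurable_one.indicator (hD m)
    exact h1.union (h2.union (measurableSet_le measurable_const h3))
  have hgk : ∀ k : Fin M × Fin L, Measurable fun c : Fin M → Fin L → X =>
      W (c k.1 k.2) (Prod.mk c ⁻¹' G k) := fun k => by
    exact measurable_kernel_comap W (f := fun c : Fin M → Fin L → X => c k.1 k.2) (hck k) (hGm k)
  have hg : Measurable g := (Finset.measurable_sum _ fun k _ => hgk k).const_mul _
  have hML0 : (M * L : ℝ≥0∞) ≠ 0 := by simp [NeZero.ne M, NeZero.ne L]
  have hMLt : (M * L : ℝ≥0∞) ≠ ∞ := by finiteness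
  have hgb : ∫⁻ c, g c ∂μ ≤ b := by
    simp only [g]
    rw [lintegral_const_mul _ (Finset.measurable_sum _ fun k _ => hgk k),
      lintegral_finsetSum _ fun k _ => hgk k]
    calc _ ≤ (M * L : ℝ≥0∞)⁻¹ * ∑ _k : Fin M × Fin L, b := by
          gcongr with k _
          rw [lintegral_kernel_comap μ W (f := fun c : Fin M → Fin L → X => c k.1 k.2) (hck k)
            (hGm k)]
          exact compProd_failure_le q W hU hU1 hV hθU0 hθU hT k (hck k)
      _ = b := by
          rw [Finset.sum_const, Finset.card_univ, Fintype.card_prod, Fintype.card_fin,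
            Fintype.card_fin, nsmul_eq_mul, Nat.cast_mul, ← mul_assoc,
            ENNReal.inv_mul_cancel hML0 hMLt, one_mul]
  have hAi0 : ENNReal.ofReal A⁻¹ ≠ 0 := (ENNReal.ofReal_pos.2 (inv_pos.2 hA)).ne'
  have hε0 : ENNReal.ofReal (1 - ε) ≠ 0 := (ENNReal.ofReal_pos.2 (sub_pos.2 hε)).ne'
  refine ⟨{c | f c ≤ ENNReal.ofReal A⁻¹} ∩ {c | g c ≤ ENNReal.ofReal (1 - ε)},
    (measurableSet_le hf measurable_const).inter (measurableSet_le hg measurable_const), ?_, ?_⟩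
  · rintro c ⟨hc1, hc2⟩
    refine canDecode_of_average_failure_le W π hU hV θU θV T c hA hc1
      (fun m l => Prod.mk c ⁻¹' G (m, l)) (fun m l z hz => ?_) ?_
    · simp only [G, Set.mem_preimage, Set.mem_ofPred_eq, not_or, not_lt, not_le] at hz
      exact ⟨hz.1, hz.2.1, card_candidates_le_of_sum_lt c z m hz.2.2⟩
    · have h1 := ENNReal.toReal_le_of_le_ofReal (sub_pos.2 hε).le hc2
      simp only [g] at h1
      rw [ENNReal.toReal_mul, ENNReal.toReal_sum fun _ _ => measure_ne_top _ _,
        Fintype.sum_prod_type] at h1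
      simpa [Measure.real] using h1
  · rw [Set.compl_inter]
    refine (measure_union_le _ _).trans (add_le_add ?_ ?_)
    · have h1 : {c | f c ≤ ENNReal.ofReal A⁻¹}ᶜ ⊆ {c | ENNReal.ofReal A⁻¹ ≤ f c} := fun c hc =>
        (not_le.1 (show ¬ f c ≤ _ from hc)).le
      refine (measure_mono h1).trans
        ((meas_ge_le_lintegral_div hf.aemeasurable hAi0 ENNReal.ofReal_ne_top).trans ?_)
      rw [ENNReal.ofReal_inv_of_pos hA, ENNReal.div_eq_inv_mul, inv_inv]
      gcongr
      exact prod_false_alarm_le q π hU hU1 hV hV1 hθU0 hθU hθV0 hθV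
    · have h1 : {c | g c ≤ ENNReal.ofReal (1 - ε)}ᶜ ⊆ {c | ENNReal.ofReal (1 - ε) ≤ g c} :=
        fun c hc => (not_le.1 (show ¬ g c ≤ _ from hc)).le
      refine (measure_mono h1).trans
        ((meas_ge_le_lintegral_div hg.aemeasurable hε0 ENNReal.ofReal_ne_top).trans ?_)
      exact ENNReal.div_le_div_right hgb _

end OneShotDirect

/-! ### Exponential estimates and code sizes. -/

section Exponentials

/-- The exponential function with values in `ℝ≥0∞`. -/
noncomputable def expE (x : ℝ) : ℝ≥0∞ := ENNReal.ofReal (Real.exp x)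

theorem expE_ne_zero (x : ℝ) : expE x ≠ 0 := (ENNReal.ofReal_pos.2 (Real.exp_pos x)).ne'

theorem expE_ne_top (x : ℝ) : expE x ≠ ∞ := ENNReal.ofReal_ne_top

theorem expE_add (x y : ℝ) : expE (x + y) = expE x * expE y := by
  rw [expE, Real.exp_add, ENNReal.ofReal_mul (Real.exp_pos x).le]; rfl

theorem expE_neg (x : ℝ) : expE (-x) = (expE x)⁻¹ := by
  rw [expE, Real.exp_neg, ENNReal.ofReal_inv_of_pos (Real.exp_pos x)]; rfl

theorem expE_mono {x y : ℝ} (h : x ≤ y) : expE x ≤ expE y :=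
  ENNReal.ofReal_le_ofReal (Real.exp_le_exp.2 h)

theorem tendsto_const_mul_expE {C : ℝ≥0∞} (hC : C ≠ ∞) {x : ℝ} (hx : x < 0) :
    Tendsto (fun n : ℕ => C * expE (n * x)) atTop (𝓝 0) := by
  have h1 : Tendsto (fun n : ℕ => Real.exp (n * x)) atTop (𝓝 0) :=
    Real.tendsto_exp_atBot.comp ((tendsto_natCast_atTop_atTop (R := ℝ)).atTop_mul_const_of_neg hx)
  have h2 := ENNReal.tendsto_ofReal h1
  rw [ENNReal.ofReal_zero] at h2
  simpa [expE] using ENNReal.Tendsto.const_mul (a := C) h2 (Or.inr hC)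

theorem expE_le_codeSize (r : ℝ) (n : ℕ) : expE (n * r) ≤ (codeSize r n : ℝ≥0∞) := by
  rw [← ENNReal.ofReal_natCast]
  exact ENNReal.ofReal_le_ofReal (Nat.le_ceil _)

theorem codeSize_real_le {r : ℝ} (hr : 0 ≤ r) (n : ℕ) :
    (codeSize r n : ℝ) ≤ 2 * Real.exp (n * r) := by
  have h1 := (Nat.ceil_lt_add_one (Real.exp_pos (n * r)).le).le
  have h2 : 1 ≤ Real.exp (n * r) := Real.one_le_exp (by positivity)
  simp only [codeSize]
  linarith

theorem codeSize_le {r : ℝ} (hr : 0 ≤ r) (n : ℕ) : (codeSize r n : ℝ≥0∞) ≤ 2 * expE (n * r) := by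
  rw [← ENNReal.ofReal_natCast]
  refine (ENNReal.ofReal_le_ofReal (codeSize_real_le hr n)).trans (le_of_eq ?_)
  rw [ENNReal.ofReal_mul (by norm_num), expE]
  simp

theorem codeSize_pos (r : ℝ) (n : ℕ) : 0 < codeSize r n := Nat.ceil_pos.2 (Real.exp_pos _)

instance (r : ℝ) (n : ℕ) : NeZero (codeSize r n) := ⟨(codeSize_pos r n).ne'⟩

/-- Turns capped union bounds into exponents with a positive part. -/
theorem min_one_mul_expE_le {C : ℝ≥0∞} (hC : 1 ≤ C) (n : ℕ) (x : ℝ) :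
    min 1 (C * expE (n * -x)) ≤ C * expE (n * -max x 0) := by
  rcases le_total x 0 with h | h
  · rw [max_eq_right h]
    refine (min_le_left _ _).trans ?_
    simpa [expE] using hC
  · rw [max_eq_left h]
    exact min_le_right _ _

end Exponentials

/-! ### Information densities of words. -/

section ProductDensity

variable {X Z : Type*} [MeasurableSpace X] [MeasurableSpace Z]

/-- Product over the letters of a density on `X × Z`. -/
noncomputable def wordDensity (h : X × Z → ℝ≥0∞) (n : ℕ) (p : (Fin n → X) × (Fin n → Z)) : ℝ≥0∞ :=
  ∏ i, h (p.1 i, p.2 i)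

theorem measurable_wordDensity {h : X × Z → ℝ≥0∞} (hm : Measurable h) (n : ℕ) :
    Measurable (wordDensity h n) := by
  unfold wordDensity; fun_prop

theorem lintegral_wordDensity_le (Q : Measure X) [IsProbabilityMeasure Q] {h : X × Z → ℝ≥0∞}
    (hm : Measurable h) (h1 : ∀ z, ∫⁻ x, h (x, z) ∂Q ≤ 1) (n : ℕ) (z : Fin n → Z) :
    ∫⁻ x, wordDensity h n (x, z) ∂(Measure.pi fun _ : Fin n => Q) ≤ 1 := by
  simp only [wordDensity]
  rw [lintegral_pi_prod (fun _ : Fin n => Q) (f := fun i x => h (x, z i)) fun i => by fun_prop]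
  exact Finset.prod_le_one' fun i _ => h1 _

theorem compProd_wordDensity_preimage (Q : Measure X) [IsProbabilityMeasure Q] (P : Kernel X Z)
    [IsMarkovKernel P] {h : X × Z → ℝ≥0∞} (hm : Measurable h) (n : ℕ) {B : Set ℝ≥0∞}
    (hB : MeasurableSet B) :
    ((Measure.pi fun _ : Fin n => Q) ⊗ₘ memorylessKernel P n) (wordDensity h n ⁻¹' B)
      = (Measure.pi fun _ : Fin n => Q ⊗ₘ P) {y | ∏ i, h (y i) ∈ B} := by
  have hp : Measurable fun y : Fin n → X × Z => ∏ i, h (y i) := by fun_prop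
  have hB' : MeasurableSet {y : Fin n → X × Z | ∏ i, h (y i) ∈ B} := hp hB
  rw [← map_zipWord_compProd Q P n, Measure.map_apply (measurable_zipWord n) hB']
  rfl

theorem memorylessKernel_eq_withDensity (Q : Measure X) [IsProbabilityMeasure Q] (P : Kernel X Z)
    [IsMarkovKernel P] {h : X × Z → ℝ≥0∞} (hm : Measurable h)
    (hP : ∀ᵐ x ∂Q, P x = (P ∘ₘ Q).withDensity fun z => h (x, z)) (n : ℕ) :
    ∀ᵐ x ∂(Measure.pi fun _ : Fin n => Q), memorylessKernel P n x =
      (memorylessKernel P n ∘ₘ (Measure.pi fun _ : Fin n => Q)).withDensity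
        fun z => wordDensity h n (x, z) := by
  filter_upwards [ae_pi_of_ae (n := n) Q hP] with x hx
  rw [memorylessKernel_comp]
  exact pi_withDensity (fun _ : Fin n => P ∘ₘ Q) (fun i => P (x i)) (f := fun i z => h (x i, z))
    (fun i => by fun_prop) hx

end ProductDensity

/-! ### Achievability: exponents and passage to the boundary. -/

section Direct

variable {X Z : Type*} [MeasurableSpace X] [MeasurableSpace Z]

theorem exists_codebooks_of_lt (Q : Measure X) [IsProbabilityMeasure Q] (P : Kernel X Z)
    [IsMarkovKernel P] (π : Measure Z) [IsProbabilityMeasure π] {R RL ε : ℝ} (hR : 0 ≤ R)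
    (hRL : 0 ≤ RL) (hε : ε < 1) {a b α τ : ℝ} (ha : (a : EReal) < (klDiv (P ∘ₘ Q) π : EReal))
    (hb : (b : EReal) < (mutualInfo Q P : EReal)) (hα : α < a + max (b - R - RL) 0)
    (hτ : R - max (b - RL) 0 < τ) :
    ∃ S : ∀ n, Set (Fin (codeSize R n) → Fin (codeSize RL n) → Fin n → X),
      (∀ n, MeasurableSet (S n)) ∧
      (∀ n, ∀ c ∈ S n, CanDecode (memorylessChannel P n) (Measure.pi fun _ : Fin n => π) c
        (Real.exp (n * α)) (codeSize τ n) ε) ∧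
      Tendsto (fun n => randomCode Q n (codeSize R n) (codeSize RL n) (S n)ᶜ) atTop (𝓝 0) := by
  obtain ⟨v, hv, hvle, hv0, hvt, hvi, hva⟩ := exists_density_of_lt_klDiv _ _ ha
  obtain ⟨u, hu, hu1, hu0, hut, hui, hub⟩ := exists_density_of_lt_mutualInfo Q P hb
  have hv1 : ∫⁻ z, v z ∂π ≤ 1 := by
    rw [← setLIntegral_univ, ← withDensity_apply _ MeasurableSet.univ]
    exact (hvle _).trans prob_le_one
  have key := fun n : ℕ => one_shot_direct (Measure.pi fun _ : Fin n => Q) (memorylessKernel P n)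
    (Measure.pi fun _ : Fin n => π) (measurable_wordDensity hu n)
    (lintegral_wordDensity_le Q hu hu1 n) (V := fun z => ∏ i, v (z i)) (by fun_prop)
    (by rw [lintegral_pi_prod (fun _ : Fin n => π) (f := fun _ => v) fun _ => hv]
        exact Finset.prod_le_one' fun i _ => hv1)
    (codeSize R n) (codeSize RL n) (expE_ne_zero (n * b)) (expE_ne_top (n * b))
    (expE_ne_zero (n * a)) (expE_ne_top (n * a)) (Real.exp_pos (n * α)) (codeSize_pos τ n).ne' hε
  choose S hS hSd hSp using key
  refine ⟨S, hS, hSd, ?_⟩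
  have hε0 : ENNReal.ofReal (1 - ε) ≠ 0 := (ENNReal.ofReal_pos.2 (sub_pos.2 hε)).ne'
  -- Each rounded-up code size costs a factor of at most `2`; both sizes occur in each of these
  -- bounds, hence `4`.
  have hfa : Tendsto (fun n : ℕ => 4 * expE (n * (α - a - max (b - R - RL) 0))) atTop (𝓝 0) :=
    tendsto_const_mul_expE (by simp) (by linarith)
  have hml : Tendsto (fun n : ℕ => 4 * expE (n * (R - max (b - RL) 0 - τ))) atTop (𝓝 0) :=
    tendsto_const_mul_expE (by simp) (by linarith)
  have hdet := tendsto_pi_prod_lt (P ∘ₘ Q) hv hv0 hvt hvi hva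
  have hdec := tendsto_pi_prod_lt (Q ⊗ₘ P) hu hu0 hut hui hub
  have hsum := (hdet.add hdec).add hml
  have hlim := hfa.add (ENNReal.Tendsto.div_const hsum (Or.inr hε0))
  simp only [add_zero, ENNReal.zero_div] at hlim
  refine tendsto_of_tendsto_of_tendsto_of_le_of_le tendsto_const_nhds hlim (fun _ => zero_le)
    fun n => (hSp n).trans ?_
  have h4 : (2 : ℝ≥0∞) * 2 = 4 := by norm_num
  have hL : (codeSize RL n : ℝ≥0∞) * (expE (n * b))⁻¹ ≤ 2 * expE (n * -(b - RL)) :=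
    calc _ ≤ 2 * expE (n * RL) * expE (-(n * b)) := by
          rw [expE_neg]
          exact mul_le_mul_left (codeSize_le hRL n) _
      _ = _ := by
          rw [show (n : ℝ) * -(b - RL) = n * RL + -(n * b) by ring, expE_add]
          ring
  have hML : (codeSize R n : ℝ≥0∞) * codeSize RL n * (expE (n * b))⁻¹
      ≤ 4 * expE (n * -(b - R - RL)) :=
    calc _ ≤ (2 * expE (n * R)) * (2 * expE (n * -(b - RL))) := by
          rw [mul_assoc]
          exact mul_le_mul' (codeSize_le hR n) hL
      _ = _ := by
          rw [show (n : ℝ) * -(b - R - RL) = n * R + n * -(b - RL) by ring, expE_add, ← h4]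
          ring
  refine add_le_add ?_ (ENNReal.div_le_div_right (add_le_add (add_le_add ?_ ?_) ?_) _)
  · calc _ ≤ expE (n * α) * (expE (n * -a) * (4 * expE (n * -max (b - R - RL) 0))) := by
          rw [mul_neg, expE_neg]
          exact mul_le_mul_right (mul_le_mul_right ((min_le_min_left 1 hML).trans
            (min_one_mul_expE_le (by norm_num) n _)) _) _
      _ = _ := by
          rw [show (n : ℝ) * (α - a - max (b - R - RL) 0)
            = n * α + n * -a + n * -max (b - R - RL) 0 by ring, expE_add, expE_add]
          ring
  · rw [memorylessKernel_comp]
    exact le_rfl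
  · exact (compProd_wordDensity_preimage Q P hu n (B := Set.Iio (expE (n * b)))
      measurableSet_Iio).le
  · calc _ ≤ 2 * expE (n * R) * (2 * expE (n * -max (b - RL) 0)) / expE (n * τ) :=
          ENNReal.div_le_div (mul_le_mul' (codeSize_le hR n) ((min_le_min_left 1 hL).trans
            (min_one_mul_expE_le (by norm_num) n _))) (expE_le_codeSize τ n)
      _ = _ := by
          rw [show (n : ℝ) * (R - max (b - RL) 0 - τ)
            = n * R + n * -max (b - RL) 0 + -(n * τ) by ring, expE_add, expE_add, expE_neg, ← h4,
            div_eq_mul_inv]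
          ring

/-- Let `κ n` be the largest `k ≤ n` whose error has fallen below `1 / (k + 1)` for good by time
`n`. -/
theorem exists_diagonal_tendsto_zero {f : ℕ → ℕ → ℝ≥0∞} (hf : ∀ k, Tendsto (f k) atTop (𝓝 0)) :
    ∃ κ : ℕ → ℕ, Tendsto κ atTop atTop ∧ Tendsto (fun n => f (κ n) n) atTop (𝓝 0) := by
  classical
  have h1 : ∀ k : ℕ, ∃ N, ∀ n ≥ N, f k n ≤ ((k + 1 : ℕ) : ℝ≥0∞)⁻¹ := fun k =>
    eventually_atTop.1 ((ENNReal.tendsto_nhds_zero.1 (hf k)) _ (by simp))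
  choose N hN using h1
  set κ : ℕ → ℕ := fun n => Nat.findGreatest (fun k => N k ≤ n) n
  have hκ : Tendsto κ atTop atTop := by
    refine tendsto_atTop.2 fun k => ?_
    filter_upwards [eventually_ge_atTop (max k (N k))] with n hn
    exact Nat.le_findGreatest ((le_max_left _ _).trans hn) ((le_max_right _ _).trans hn)
  refine ⟨κ, hκ, ?_⟩
  have h2 : Tendsto (fun n => ((κ n + 1 : ℕ) : ℝ≥0∞)⁻¹) atTop (𝓝 0) :=
    ENNReal.tendsto_inv_nat_nhds_zero.comp ((tendsto_add_atTop_nat 1).comp hκ)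
  refine tendsto_of_tendsto_of_tendsto_of_le_of_le' tendsto_const_nhds h2
    (Eventually.of_forall fun _ => zero_le) ?_
  -- `Nat.findGreatest` defaults to `0`, and from `N 0` on this default satisfies the predicate too.
  filter_upwards [eventually_ge_atTop (N 0)] with n hn
  exact hN _ _ (Nat.findGreatest_spec (P := fun k => N k ≤ n) (Nat.zero_le n) hn)

/-- The positive part is 1-Lipschitz, so lowering a finite `D` and a finite `I` by `δ / 4` each
costs less than `δ` in either inequality. -/
theorem exists_exponents {D I : EReal} (hD : 0 ≤ D) (hI : 0 ≤ I) {R RL α τ δ : ℝ} (hδ : 0 < δ)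
    (hα : (α : EReal) ≤ D + max (I - (R : EReal) - (RL : EReal)) 0)
    (hτ : (R : EReal) - max (I - (RL : EReal)) 0 ≤ (τ : EReal)) (hτ0 : 0 ≤ τ) :
    ∃ a b : ℝ, (a : EReal) < D ∧ (b : EReal) < I ∧ α - δ < a + max (b - R - RL) 0 ∧
      R - max (b - RL) 0 < τ + δ := by
  rcases eq_or_ne I ⊤ with rfl | hIt
  -- As `D` may vanish, `a` is taken negative. The first entry of the maximum makes up for `-1` in
  -- the detection exponent; the second makes the list exponent nonpositive, so that `0 ≤ τ`
  -- suffices.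
  · refine ⟨-1, max (α + R + RL + 1) (R + RL), ?_, EReal.coe_lt_top _, ?_, ?_⟩
    · exact lt_of_lt_of_le (by exact_mod_cast (by norm_num : (-1 : ℝ) < 0)) hD
    · have h1 := le_max_left (α + R + RL + 1) (R + RL)
      have h2 := le_max_left (max (α + R + RL + 1) (R + RL) - R - RL) 0
      linarith
    · have h1 := le_max_right (α + R + RL + 1) (R + RL)
      have h2 := le_max_left (max (α + R + RL + 1) (R + RL) - RL) 0
      linarith
  lift I to ℝ using ⟨hIt, ne_bot_of_le_ne_bot (by simp) hI⟩
  have hmax : max ((I : EReal) - (RL : EReal)) 0 = ((max (I - RL) 0 : ℝ) : EReal) := by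
    rw [EReal.coe_strictMono.monotone.map_max]; simp
  have hmax' : max ((I : EReal) - (R : EReal) - (RL : EReal)) 0
      = ((max (I - R - RL) 0 : ℝ) : EReal) := by
    rw [EReal.coe_strictMono.monotone.map_max]; simp
  rw [hmax] at hτ
  rw [hmax'] at hα
  have hτ' : R - max (I - RL) 0 ≤ τ := by exact_mod_cast hτ
  have hstep : ∀ x : ℝ, max (x - 0) 0 - δ / 4 ≤ max (x - δ / 4) 0 := fun x => by
    rcases le_total x 0 with h | h
    · rw [max_eq_right (by linarith)]
      linarith [le_max_right (x - δ / 4) 0]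
    · rw [max_eq_left (by linarith)]
      linarith [le_max_left (x - δ / 4) 0]
  have hs1 := hstep (I - RL)
  have hs2 := hstep (I - R - RL)
  rw [sub_zero] at hs1 hs2
  have e1 : I - δ / 4 - RL = I - RL - δ / 4 := by ring
  have e2 : I - δ / 4 - R - RL = I - R - RL - δ / 4 := by ring
  have hbI : ((I - δ / 4 : ℝ) : EReal) < I := by exact_mod_cast (by linarith : I - δ / 4 < I)
  rcases eq_or_ne D ⊤ with rfl | hDt
  · refine ⟨α, I - δ / 4, EReal.coe_lt_top _, hbI, ?_, ?_⟩
    · linarith [le_max_right (I - δ / 4 - R - RL) 0]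
    · rw [e1]; linarith
  lift D to ℝ using ⟨hDt, ne_bot_of_le_ne_bot (by simp) hD⟩
  have hα' : α ≤ D + max (I - R - RL) 0 := by exact_mod_cast hα
  refine ⟨D - δ / 4, I - δ / 4, by exact_mod_cast (by linarith : D - δ / 4 < D), hbI, ?_, ?_⟩
  · rw [e2]; linarith
  · rw [e1]; linarith

theorem achievable_of_le (Q : Measure X) [IsProbabilityMeasure Q] (P : Kernel X Z)
    [IsMarkovKernel P] (π : Measure Z) [IsProbabilityMeasure π] {R RL ε α τ : ℝ} (hR : 0 ≤ R)
    (hRL : 0 ≤ RL) (hε : ε < 1)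
    (hα : (α : EReal) ≤ (klDiv (P ∘ₘ Q) π : EReal)
          + max ((mutualInfo Q P : EReal) - (R : EReal) - (RL : EReal)) 0)
    (hτ : (R : EReal) - max ((mutualInfo Q P : EReal) - (RL : EReal)) 0 ≤ (τ : EReal))
    (hτ0 : 0 ≤ τ) : Achievable Q P π R RL ε α τ := by
  have hδ : ∀ k : ℕ, (0 : ℝ) < 1 / ((k : ℝ) + 1) := fun k => by positivity
  have key : ∀ k : ℕ, ∃ S : ∀ n, Set (Fin (codeSize R n) → Fin (codeSize RL n) → Fin n → X),
      (∀ n, MeasurableSet (S n)) ∧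
      (∀ n, ∀ c ∈ S n, CanDecode (memorylessChannel P n) (Measure.pi fun _ : Fin n => π) c
        (Real.exp (n * (α - 1 / ((k : ℝ) + 1)))) (codeSize (τ + 1 / ((k : ℝ) + 1)) n) ε) ∧
      Tendsto (fun n => randomCode Q n (codeSize R n) (codeSize RL n) (S n)ᶜ) atTop (𝓝 0) := by
    intro k
    obtain ⟨a, b, ha, hb, h1, h2⟩ := exists_exponents (EReal.coe_ennreal_nonneg _)
      (EReal.coe_ennreal_nonneg _) (hδ k) hα hτ hτ0
    exact exists_codebooks_of_lt Q P π hR hRL hε ha hb h1 h2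
  choose S hS hSd hSp using key
  obtain ⟨κ, hκ, hκ0⟩ := exists_diagonal_tendsto_zero hSp
  have hδ0 : Tendsto (fun n => 1 / ((κ n : ℝ) + 1)) atTop (𝓝 0) :=
    tendsto_one_div_add_atTop_nhds_zero_nat.comp hκ
  refine ⟨fun n => Real.exp (n * (α - 1 / ((κ n : ℝ) + 1))),
    fun n => codeSize (τ + 1 / ((κ n : ℝ) + 1)) n, fun n => Real.exp_pos _,
    fun n => codeSize_pos _ _, ?_, ?_, fun n => S (κ n) n, fun n => hS _ _, fun n => hSd _ _, ?_⟩
  · have hlow : Tendsto (fun n => τ + 1 / ((κ n : ℝ) + 1)) atTop (𝓝 τ) := by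
      simpa using hδ0.const_add τ
    have hup : Tendsto (fun n : ℕ => τ + 1 / ((κ n : ℝ) + 1) + Real.log 2 / n) atTop (𝓝 τ) := by
      simpa using hlow.add (tendsto_const_div_atTop_nhds_zero_nat (Real.log 2))
    refine tendsto_of_tendsto_of_tendsto_of_le_of_le' hlow hup ?_ ?_
    all_goals
      filter_upwards [eventually_gt_atTop 0] with n hn
      have hn' : (0 : ℝ) < n := by exact_mod_cast hn
    · rw [le_div_iff₀ hn', mul_comm, Real.le_log_iff_exp_le (by exact_mod_cast codeSize_pos _ _)]
      exact Nat.le_ceil _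
    · rw [div_le_iff₀ hn', add_mul, div_mul_cancel₀ _ hn'.ne']
      have h1 := codeSize_real_le (r := τ + 1 / ((κ n : ℝ) + 1)) (by have := hδ (κ n); linarith) n
      refine (Real.log_le_log (by exact_mod_cast codeSize_pos _ _) h1).trans (le_of_eq ?_)
      rw [Real.log_mul (by norm_num) (Real.exp_pos _).ne', Real.log_exp]
      ring
  · have hlim : Tendsto (fun n => α - 1 / ((κ n : ℝ) + 1)) atTop (𝓝 α) := by
      simpa using hδ0.const_sub α
    refine hlim.congr' ?_
    filter_upwards [eventually_gt_atTop 0] with n hn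
    have hn' : (n : ℝ) ≠ 0 := by exact_mod_cast hn.ne'
    rw [Real.log_exp, mul_div_cancel_left₀ _ hn']
  · have hprob : ∀ n, IsProbabilityMeasure (randomCode Q n (codeSize R n) (codeSize RL n)) :=
      fun n => by unfold randomCode; infer_instance
    have h1 : ∀ n, randomCode Q n (codeSize R n) (codeSize RL n) (S (κ n) n)
        = 1 - randomCode Q n (codeSize R n) (codeSize RL n) (S (κ n) n)ᶜ := fun n => by
      rw [prob_compl_eq_one_sub (hS _ _), ENNReal.sub_sub_cancel ENNReal.one_ne_top prob_le_one]
    simp_rw [h1]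
    simpa using ENNReal.Tendsto.sub (tendsto_const_nhds (x := (1 : ℝ≥0∞))) hκ0 (Or.inl (by simp))

end Direct

/-! ### Asymptotic converse. -/

section Converse

variable {X Z : Type*} [MeasurableSpace X] [MeasurableSpace Z]

/-- This is the condition `2 * t ≤ γ * N` of soft covering. The `δ` in `γ` also makes `2 / γ` vanish
when the positive part is zero. -/
theorem two_mul_expE_le (I r δ : ℝ) (n : ℕ) {N : ℝ≥0∞} (hN : expE (n * r) ≤ N) :
    2 * expE (n * (I + δ)) ≤ 2 * expE (n * (max (I - r) 0 + δ)) * N := by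
  calc 2 * expE (n * (I + δ)) ≤ 2 * (expE (n * (max (I - r) 0 + δ)) * expE (n * r)) := by
        rw [← expE_add]
        refine mul_le_mul_right (expE_mono ?_) _
        rw [← mul_add]
        refine mul_le_mul_of_nonneg_left ?_ n.cast_nonneg
        linarith [le_max_left (I - r) 0]
    _ ≤ _ := by
        rw [mul_assoc]
        exact mul_le_mul_right (mul_le_mul_right hN _) _

theorem tendsto_two_div_expE {x : ℝ} (hx : 0 < x) :
    Tendsto (fun n : ℕ => 2 / (2 * expE (n * x))) atTop (𝓝 0) := by
  refine (tendsto_const_mul_expE ENNReal.one_ne_top (neg_neg_iff_pos.2 hx)).congr fun n => ?_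
  rw [mul_neg, expE_neg, one_mul, ENNReal.div_eq_inv_mul,
    ENNReal.mul_inv (by simp) (by simp), mul_comm (2 : ℝ≥0∞)⁻¹, mul_assoc,
    ENNReal.inv_mul_cancel (by simp) (by simp), mul_one]

/-- The bound `b` is free of `ε`, so every positive `ε` is excluded. -/
theorem false_of_mul_le_tendsto_zero {ε : ℝ} (hε : 0 < ε) {p b : ℕ → ℝ≥0∞}
    (hp : Tendsto p atTop (𝓝 1)) (hb : Tendsto b atTop (𝓝 0))
    (h : ∀ᶠ n in atTop, ENNReal.ofReal ε * p n ≤ b n) : False := by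
  have h1 := ENNReal.Tendsto.const_mul (a := ENNReal.ofReal ε) hp (Or.inl one_ne_zero)
  have h2 := le_of_tendsto_of_tendsto h1 hb h
  simp only [mul_one, nonpos_iff_eq_zero, ENNReal.ofReal_eq_zero] at h2
  linarith

theorem nonneg_of_achievable {Q : Measure X} {P : Kernel X Z} {π : Measure Z} {R RL ε α τ : ℝ}
    (h : Achievable Q P π R RL ε α τ) : 0 ≤ τ := by
  obtain ⟨A, T, -, hT, hτ, -⟩ := h
  refine ge_of_tendsto' hτ fun n => div_nonneg (Real.log_nonneg ?_) n.cast_nonneg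
  exact_mod_cast hT n

theorem list_rate_le_of_achievable [MeasurableSpace.CountablyGenerated Z]
    (Q : Measure X) [IsProbabilityMeasure Q] (P : Kernel X Z)
    [IsMarkovKernel P] (π : Measure Z) [IsProbabilityMeasure π] {R RL ε α τ : ℝ}
    (hε : 0 < ε) (hI : mutualInfo Q P ≠ ∞) (h : Achievable Q P π R RL ε α τ) :
    R - max ((mutualInfo Q P).toReal - RL) 0 ≤ τ := by
  obtain ⟨A, T, hA, hT, hτ, hα, S, hS, hSd, hSp⟩ := h
  by_contra! hlt
  set I := (mutualInfo Q P).toReal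
  -- A quarter of the gap: one `δ` is spent on `γ` and one on `T`, and the exponent stays negative.
  obtain ⟨δ, hδ, hδ'⟩ : ∃ δ : ℝ, 0 < δ ∧ max (I - RL) 0 + δ + (τ + δ) - R < 0 :=
    ⟨(R - max (I - RL) 0 - τ) / 4, by linarith, by linarith⟩
  obtain ⟨u, hu, hu1, hu0, hut, hui, huI, huP⟩ := exists_density_of_mutualInfo_ne_top Q P hI
  have hmax : 0 ≤ max (I - RL) 0 := le_max_right _ _
  refine false_of_mul_le_tendsto_zero hε hSp (b := fun n : ℕ =>
    (Measure.pi fun _ : Fin n => Q ⊗ₘ P) {y | expE (n * (I + δ)) < ∏ i, u (y i)}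
      + 2 / (2 * expE (n * (max (I - RL) 0 + δ)))
      + 2 * expE (n * (max (I - RL) 0 + δ + (τ + δ) - R))) ?_ ?_
  · have h1 := tendsto_pi_prod_gt (Q ⊗ₘ P) hu hu0 hut hui (t := I + δ) (by linarith)
    have h2 := (h1.add (tendsto_two_div_expE (x := max (I - RL) 0 + δ) (by linarith))).add
      (tendsto_const_mul_expE (C := 2) (by simp) hδ')
    simp only [add_zero] at h2
    exact h2
  · filter_upwards [eventually_gt_atTop 0, hτ.eventually_lt_const (by linarith : τ < τ + δ)] with n
      hn hTn
    have hn' : (0 : ℝ) < n := by exact_mod_cast hn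
    have hTle : (T n : ℝ≥0∞) ≤ expE (n * (τ + δ)) := by
      rw [← ENNReal.ofReal_natCast]
      refine ENNReal.ofReal_le_ofReal ?_
      rw [div_lt_iff₀ hn', mul_comm] at hTn
      exact (Real.log_le_iff_le_exp (by exact_mod_cast hT n)).1 hTn.le
    have key := one_shot_list_converse (Measure.pi fun _ : Fin n => Q) (memorylessKernel P n)
      (Measure.pi fun _ : Fin n => π) (measurable_wordDensity hu n)
      (lintegral_wordDensity_le Q hu hu1 n) (memorylessKernel_eq_withDensity Q P hu huP n)
      (t := expE (n * (I + δ))) (γ := 2 * expE (n * (max (I - RL) 0 + δ)))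
      (by simp [expE_ne_zero]) (ENNReal.mul_ne_top (by simp) (expE_ne_top _))
      (two_mul_expE_le I RL δ n (expE_le_codeSize RL n)) (hS n) (hSd n)
    refine key.trans (add_le_add (add_le_add ?_ le_rfl) ?_)
    · exact (compProd_wordDensity_preimage Q P hu n (B := Set.Ioi (expE (n * (I + δ))))
        measurableSet_Ioi).le
    · calc _ ≤ 2 * expE (n * (max (I - RL) 0 + δ)) * expE (n * (τ + δ)) / expE (n * R) :=
            ENNReal.div_le_div (mul_le_mul_right hTle _) (expE_le_codeSize R n)
        _ = _ := by
            rw [show (n : ℝ) * (max (I - RL) 0 + δ + (τ + δ) - R)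
              = n * (max (I - RL) 0 + δ) + n * (τ + δ) + -(n * R) by ring, expE_add, expE_add,
              expE_neg, div_eq_mul_inv]
            ring

theorem detection_exponent_le_of_achievable [MeasurableSpace.CountablyGenerated Z]
    (Q : Measure X) [IsProbabilityMeasure Q] (P : Kernel X Z)
    [IsMarkovKernel P] (π : Measure Z) [IsProbabilityMeasure π] {R RL ε α τ : ℝ}
    (hε : 0 < ε) (hI : mutualInfo Q P ≠ ∞) (hD : klDiv (P ∘ₘ Q) π ≠ ∞)
    (h : Achievable Q P π R RL ε α τ) :
    α ≤ (klDiv (P ∘ₘ Q) π).toReal + max ((mutualInfo Q P).toReal - R - RL) 0 := by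
  obtain ⟨A, T, hA, hT, hτ, hα, S, hS, hSd, hSp⟩ := h
  by_contra! hlt
  set I := (mutualInfo Q P).toReal
  set D := (klDiv (P ∘ₘ Q) π).toReal
  rw [sub_sub] at hlt
  -- Here `γ`, `θ` and `A` each spend a quarter of the gap.
  obtain ⟨δ, hδ, hδ'⟩ : ∃ δ : ℝ, 0 < δ ∧ max (I - (R + RL)) 0 + δ + (D + δ) - (α - δ) < 0 :=
    ⟨(α - D - max (I - (R + RL)) 0) / 4, by linarith, by linarith⟩
  obtain ⟨u, hu, hu1, hu0, hut, hui, huI, huP⟩ := exists_density_of_mutualInfo_ne_top Q P hI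
  obtain ⟨hvD, hv0, hvt, hvi, hvint⟩ := log_density_of_klDiv_ne_top _ _ hD
  set v := (P ∘ₘ Q).rnDeriv π
  have hv : Measurable v := Measure.measurable_rnDeriv _ _
  have hmax : 0 ≤ max (I - (R + RL)) 0 := le_max_right _ _
  refine false_of_mul_le_tendsto_zero hε hSp (b := fun n : ℕ =>
    (Measure.pi fun _ : Fin n => Q ⊗ₘ P) {y | expE (n * (I + δ)) < ∏ i, u (y i)}
      + 2 / (2 * expE (n * (max (I - (R + RL)) 0 + δ)))
      + (Measure.pi fun _ : Fin n => P ∘ₘ Q) {y | expE (n * (D + δ)) < ∏ i, v (y i)}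
      + 2 * expE (n * (max (I - (R + RL)) 0 + δ + (D + δ) - (α - δ)))) ?_ ?_
  · have h1 := tendsto_pi_prod_gt (Q ⊗ₘ P) hu hu0 hut hui (t := I + δ) (by linarith)
    have h2 := tendsto_pi_prod_gt (P ∘ₘ Q) hv hv0 hvt hvi (t := D + δ) (by linarith)
    have h3 := ((h1.add (tendsto_two_div_expE (x := max (I - (R + RL)) 0 + δ)
      (by linarith))).add h2).add (tendsto_const_mul_expE (C := 2) (by simp) hδ')
    simp only [add_zero] at h3
    exact h3
  · filter_upwards [eventually_gt_atTop 0, hα.eventually_const_lt (by linarith : α - δ < α)] with n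
      hn hAn
    have hn' : (0 : ℝ) < n := by exact_mod_cast hn
    have hAle : ENNReal.ofReal (A n)⁻¹ ≤ expE (-(n * (α - δ))) := by
      refine ENNReal.ofReal_le_ofReal ?_
      rw [lt_div_iff₀ hn', mul_comm] at hAn
      rw [Real.exp_neg]
      exact inv_anti₀ (Real.exp_pos _) ((Real.le_log_iff_exp_le (hA n)).1 hAn.le)
    have hVπ : memorylessKernel P n ∘ₘ (Measure.pi fun _ : Fin n => Q)
        = (Measure.pi fun _ : Fin n => π).withDensity fun z => ∏ i, v (z i) := by
      rw [memorylessKernel_comp]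
      exact pi_withDensity (fun _ : Fin n => π) (fun _ => P ∘ₘ Q) (fun _ => hv) fun _ => hvD.symm
    have hcs : expE (n * (R + RL)) ≤ (codeSize R n * codeSize RL n : ℝ≥0∞) := by
      rw [mul_add, expE_add]
      exact mul_le_mul' (expE_le_codeSize R n) (expE_le_codeSize RL n)
    have key := one_shot_detection_converse (Measure.pi fun _ : Fin n => Q) (memorylessKernel P n)
      (Measure.pi fun _ : Fin n => π) (measurable_wordDensity hu n)
      (lintegral_wordDensity_le Q hu hu1 n) (memorylessKernel_eq_withDensity Q P hu huP n)
      (V := fun z => ∏ i, v (z i)) (by fun_prop) hVπ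
      (t := expE (n * (I + δ))) (γ := 2 * expE (n * (max (I - (R + RL)) 0 + δ)))
      (θ := expE (n * (D + δ)))
      (by simp [expE_ne_zero]) (ENNReal.mul_ne_top (by simp) (expE_ne_top _))
      (two_mul_expE_le I (R + RL) δ n hcs) (hS n) (hSd n)
    refine key.trans (add_le_add (add_le_add (add_le_add ?_ le_rfl) ?_) ?_)
    · exact (compProd_wordDensity_preimage Q P hu n (B := Set.Ioi (expE (n * (I + δ))))
        measurableSet_Ioi).le
    · rw [memorylessKernel_comp]
    · refine (mul_le_mul_right hAle _).trans (le_of_eq ?_)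
      rw [show (n : ℝ) * (max (I - (R + RL)) 0 + δ + (D + δ) - (α - δ))
        = n * (max (I - (R + RL)) 0 + δ) + n * (D + δ) + -(n * (α - δ)) by ring, expE_add,
        expE_add]
      ring

end Converse

end Wiretap

/-! ### The achievable region. -/

theorem mainTheorem3 {X Z : Type*} [MeasurableSpace X] [MeasurableSpace Z]
    [MeasurableSpace.CountablyGenerated Z]
    (Q : Measure X) [IsProbabilityMeasure Q]
    (P : Kernel X Z) [IsMarkovKernel P]
    (π : Measure Z) [IsProbabilityMeasure π]
    (R RL ε : ℝ) (hR : 0 ≤ R) (hRL : 0 ≤ RL) (hε0 : 0 < ε) (hε1 : ε < 1) (α τ : ℝ) :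
    Wiretap.Achievable Q P π R RL ε α τ ↔
      ((α : EReal) ≤ (klDiv (P ∘ₘ Q) π : EReal)
          + max ((Wiretap.mutualInfo Q P : EReal) - (R : EReal) - (RL : EReal)) 0) ∧
      ((R : EReal) - max ((Wiretap.mutualInfo Q P : EReal) - (RL : EReal)) 0 ≤ (τ : EReal)) ∧
      0 ≤ τ := by
  constructor
  · intro h
    refine ⟨?_, ?_, Wiretap.nonneg_of_achievable h⟩
    -- If `I` or `D` is infinite, the bound on `α` is `⊤`; below, infinite `I` makes the bound on
    -- `τ` equal to `⊥`. The converse thus has content only for finite quantities.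
    · by_cases hI : Wiretap.mutualInfo Q P = ∞
      · rw [hI, EReal.coe_ennreal_top, EReal.top_sub_coe, EReal.top_sub_coe,
          max_eq_left le_top, EReal.add_top_of_ne_bot (EReal.coe_ennreal_ne_bot _)]
        exact le_top
      by_cases hD : klDiv (P ∘ₘ Q) π = ∞
      · rw [hD, EReal.coe_ennreal_top, EReal.top_add_of_ne_bot
          (ne_bot_of_le_ne_bot EReal.zero_ne_bot (le_max_right _ _))]
        exact le_top
      have h1 := Wiretap.detection_exponent_le_of_achievable Q P π hε0 hI hD h
      rw [← EReal.coe_ennreal_toReal hI, ← EReal.coe_ennreal_toReal hD, ← EReal.coe_sub,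
        ← EReal.coe_sub, ← EReal.coe_zero, ← EReal.coe_strictMono.monotone.map_max]
      exact_mod_cast h1
    · by_cases hI : Wiretap.mutualInfo Q P = ∞
      · rw [hI, EReal.coe_ennreal_top, EReal.top_sub_coe, max_eq_left le_top, EReal.sub_top]
        exact bot_le
      have h1 := Wiretap.list_rate_le_of_achievable Q P π hε0 hI h
      rw [← EReal.coe_ennreal_toReal hI, ← EReal.coe_sub, ← EReal.coe_zero,
        ← EReal.coe_strictMono.monotone.map_max]
      exact_mod_cast h1
  · rintro ⟨h1, h2, h3⟩
    exact Wiretap.achievable_of_le Q P π hR hRL hε1 h1 h2 h3
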